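/- Conventions. Graphs are simple, with vertex set $\{1,\dots,n\}$. A multigraph has vertices $1,\dots,n$ and labelled oriented edges, i.e. triples $(v,w,e)$ with $v,w$ vertices (possibly equal) and $e$ the edge label, the labels $1,\dots,m$ being used once each. The excess is $m-n$, the number of edges minus the number of vertices. The generating function of a family $\mathcal F$ of graphs is $F(z,w)=\sum_{G\in\mathcal F}w^{m(G)}\frac{z^{n(G)}}{n(G)!}$, that of a family of multigraphs is $F(z,w)=\sum_{G\in\mathcal F}\frac{w^{m(G)}}{2^{m(G)}m(G)!}\frac{z^{n(G)}}{n(G)!}$, and in both cases $F_k(z)=[y^k]F(z/y,y)$ is the part of excess $k$. Let $T(z)$ be the exponential generating function of rooted labelled trees, $V(z)$ the generating function of unicycles (connected graphs of excess $0$) and $\mathit{MV}(z)$ that of multi-unicycles (connected multigraphs of excess $0$), both taken at excess $0$. Let $\mathrm{SG}^{>0}_k(z)$ (resp. $\mathrm{MG}^{>0}_k(z)$) be the generating function of the graphs (resp. multigraphs) of excess $k$ all of whose connected components have positive excess. A loop of a multigraph is a subgraph with one vertex $v$ and one edge from $v$ to $v$; a double edge is a subgraph with two distinct vertices and two distinct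 edges between them, of any orientations. A patchwork is a finite set $P=\{(V_1,E_1),\dots,(V_p,E_p)\}$ such that $\mathrm{MG}(P)=(\bigcup_i V_i,\bigcup_i E_i)$ is a multigraph and each $(V_i,E_i)$ is a loop or a double edge of it. Its number of parts is $|P|=p$; its numbers $n(P)$ of vertices and $m(P)$ of edges are those of $\mathrm{MG}(P)$. Let $P(z,w,u)=\sum_P u^{|P|}\frac{w^{m(P)}}{2^{m(P)}m(P)!}\frac{z^{n(P)}}{n(P)!}$ and $P_\ell(z,u)=[y^\ell]P(z/y,y,u)$. Finally, $(2j-1)!!=\frac{(2j)!}{2^jj!}$. Lemma. For every integer $k\ge 0$, as formal power series in $z$ (coefficients $[x^{d}]$ being extracted from formal power series in $z$ and $x$), $$\mathrm{SG}^{>0}_k(z)=\sum_{\ell=0}^k(2(k-\ell)-1)!!\,[x^{2(k-\ell)}]\frac{P_\ell(T(z)e^x,-1)\,e^{-V(z)}}{\left(1-T(z)\frac{e^x-1-x}{x^2/2}\right)^{k-\ell+1/2}}.$$ Moreover $$\mathrm{MG}^{>0}_k(z)=(2k-1)!!\,[x^{2k}]\frac{e^{-\mathit{MV}(z)}}{\left(1-T(z)\frac{e^x-1-x}{x^2/2}\right)^{k+1/2}},$$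 and $\mathrm{SG}^{>0}_k(z)$ is coefficient-wise at most $\mathrm{MG}^{>0}_k(z)$: $[z^n]\mathrm{SG}^{>0}_k(z)\le[z^n]\mathrm{MG}^{>0}_k(z)$ for all $n\ge0$. -/

import Mathlib

open scoped PowerSeries Nat

noncomputable section

namespace PosExcess

/-! ### Bivariate formal power series

A bivariate series over `ℚ` is an element of `ℚ⟦X⟧⟦X⟧`. The outer variable is always `z`;
the inner variable is `w` (marking edges) in generating functions and `x` in the closed formulas. -/

/-- `F_k(z) = [y^k] F(z/y, y)`: since `F(z/y, y) = ∑ f_{n,m} z^n y^{m-n}`, the coefficient of `z^n`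
in `F_k` is the coefficient of `z^n w^{n+k}` in `F(z, w)`. -/
def excessPart (F : ℚ⟦X⟧⟦X⟧) (k : ℕ) : ℚ⟦X⟧ :=
  PowerSeries.mk fun n => PowerSeries.coeff (n + k) (PowerSeries.coeff n F)

/-- `[x^d] F(z, x)`, a series in `z`. -/
def coeffX (d : ℕ) (F : ℚ⟦X⟧⟦X⟧) : ℚ⟦X⟧ :=
  PowerSeries.mk fun n => PowerSeries.coeff d (PowerSeries.coeff n F)

/-- A series `f(z)` seen as a bivariate series in `z` and `x`. -/
def inZ (f : ℚ⟦X⟧) : ℚ⟦X⟧⟦X⟧ := PowerSeries.map (PowerSeries.C (R := ℚ)) f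

/-- A series `g(x)` seen as a bivariate series in `z` and `x`. -/
def inX (g : ℚ⟦X⟧) : ℚ⟦X⟧⟦X⟧ := PowerSeries.C g

/-- The substitution `f(A(z, x))`, for `A` with `A(0, x) = 0`. -/
def comp (f : ℚ⟦X⟧) (A : ℚ⟦X⟧⟦X⟧) : ℚ⟦X⟧⟦X⟧ := PowerSeries.subst A f

/-- `e^{A(z)}`, for `A` with `A(0) = 0`. -/
def expOf (A : ℚ⟦X⟧) : ℚ⟦X⟧ := PowerSeries.subst A (PowerSeries.exp ℚ)

/-- `1 / (1 - A(z, x))^s` for a rational exponent `s` and `A` with `A(0, x) = 0`, through the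
binomial series of `(1 + t)^{-s}` at `t = -A`. -/
def invOneSubRPow (A : ℚ⟦X⟧⟦X⟧) (s : ℚ) : ℚ⟦X⟧⟦X⟧ :=
  comp (PowerSeries.binomialSeries ℚ (-s)) (-A)

/-- The power series `(e^x - 1 - x) / (x^2 / 2)`. -/
def phi : ℚ⟦X⟧ := PowerSeries.mk fun n => 2 / ((n + 2)! : ℚ)

theorem phi_mul : phi * (PowerSeries.C (1 / 2 : ℚ) * PowerSeries.X ^ 2)
    = PowerSeries.exp ℚ - 1 - PowerSeries.X := by
  ext n
  rw [mul_left_comm, PowerSeries.coeff_C_mul, PowerSeries.coeff_mul_X_pow']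
  match n with
  | 0 => simp
  | 1 => simp [PowerSeries.coeff_exp, PowerSeries.coeff_one]
  | n + 2 =>
    have : ((n + 2)! : ℚ) ≠ 0 := by exact_mod_cast Nat.factorial_ne_zero _
    simp [phi, PowerSeries.coeff_exp, PowerSeries.coeff_one, PowerSeries.coeff_X]
    field_simp

/-- `(2j - 1)!! = (2j)! / (2^j j!)`. -/
def oddDoubleFactorial (j : ℕ) : ℚ := ((2 * j)! : ℚ) / (2 ^ j * (j ! : ℚ))

/-! ### Graphs -/

/-- The excess of a graph: number of edges minus number of vertices. -/
def graphExcess {V : Type*} (G : SimpleGraph V) : ℤ := (G.edgeSet.ncard : ℤ) - Nat.card V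

/-- Exponential in the vertices, ordinary in the edges: `∑_{G ∈ F} w^{m(G)} z^{n(G)} / n(G)!`. -/
def graphGF (F : ∀ n : ℕ, Set (SimpleGraph (Fin n))) : ℚ⟦X⟧⟦X⟧ :=
  PowerSeries.mk fun n => PowerSeries.mk fun m =>
    (({G : SimpleGraph (Fin n) | G ∈ F n ∧ G.edgeSet.ncard = m}.ncard : ℕ) : ℚ) / (n ! : ℚ)

/-- Graphs all of whose connected components have positive excess. -/
def posGraphs (n : ℕ) : Set (SimpleGraph (Fin n)) :=
  {G | ∀ c : G.ConnectedComponent, 0 < graphExcess c.toSimpleGraph}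

/-- Unicycles: connected graphs of excess `0`. -/
def unicycles (n : ℕ) : Set (SimpleGraph (Fin n)) :=
  {G | G.Connected ∧ graphExcess G = 0}

/-- `SG^{>0}_k(z)`. -/
def sgPos (k : ℕ) : ℚ⟦X⟧ := excessPart (graphGF posGraphs) k

/-- `V(z)`, the generating function of unicycles. -/
def unicycleGF : ℚ⟦X⟧ := excessPart (graphGF unicycles) 0

/-- `T(z)`, the exponential generating function of rooted labelled trees. -/
def rootedTreeGF : ℚ⟦X⟧ :=
  PowerSeries.mk fun n =>
    (({p : SimpleGraph (Fin n) × Fin n | p.1.IsTree}.ncard : ℕ) : ℚ) / (n ! : ℚ)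

/-! ### Multigraphs -/

/-- A multigraph with `n` labelled vertices and `m` labelled oriented edges (loops and multiple
edges allowed): the edge with label `e` is the triple `(v, w, e)` where `G e = (v, w)`. -/
abbrev Multigraph (n m : ℕ) : Type := Fin m → Fin n × Fin n

namespace Multigraph

variable {n m : ℕ}

/-- The edge set, as a set of triples `(v, w, e)`. -/
def edges (G : Multigraph n m) : Finset (Fin n × Fin n × Fin m) :=
  Finset.univ.image fun e => ((G e).1, (G e).2, e)

/-- The simple graph joining distinct vertices linked by at least one edge; it has the same
connected components as the multigraph. -/
def underlying (G : Multigraph n m) : SimpleGraph (Fin n) :=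
  SimpleGraph.fromRel fun v w => ∃ e, G e = (v, w)

/-- The excess of a connected component. -/
def componentExcess (G : Multigraph n m) (c : G.underlying.ConnectedComponent) : ℤ :=
  ({e : Fin m | (G e).1 ∈ c.supp ∧ (G e).2 ∈ c.supp}.ncard : ℤ) - c.supp.ncard

end Multigraph

/-- `∑_{G ∈ F} w^{m(G)} / (2^{m(G)} m(G)!) * z^{n(G)} / n(G)!`. -/
def multigraphGF (F : ∀ n m : ℕ, Set (Multigraph n m)) : ℚ⟦X⟧⟦X⟧ :=
  PowerSeries.mk fun n => PowerSeries.mk fun m =>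
    (((F n m).ncard : ℕ) : ℚ) / (2 ^ m * (m ! : ℚ) * (n ! : ℚ))

/-- Multigraphs all of whose connected components have positive excess. -/
def posMultigraphs (n m : ℕ) : Set (Multigraph n m) :=
  {G | ∀ c : G.underlying.ConnectedComponent, 0 < G.componentExcess c}

/-- Multi-unicycles: connected multigraphs of excess `0`. -/
def multiUnicycles (n m : ℕ) : Set (Multigraph n m) :=
  {G | G.underlying.Connected ∧ (m : ℤ) - n = 0}

/-- `MG^{>0}_k(z)`. -/
def mgPos (k : ℕ) : ℚ⟦X⟧ := excessPart (multigraphGF posMultigraphs) k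

/-- `MV(z)`, the generating function of multi-unicycles. -/
def multiUnicycleGF : ℚ⟦X⟧ := excessPart (multigraphGF multiUnicycles) 0

/-! ### Patchworks -/

/-- A pair (vertices, edges). -/
abbrev Part (n m : ℕ) : Type := Finset (Fin n) × Finset (Fin n × Fin n × Fin m)

/-- One vertex with one edge from it to itself. -/
def IsLoop {n m : ℕ} (p : Part n m) : Prop :=
  ∃ (v : Fin n) (e : Fin m), p = ({v}, {(v, v, e)})

/-- Two distinct vertices with two distinct edges between them, oriented either in the same
direction or in opposite directions. -/
def IsDoubleEdge {n m : ℕ} (p : Part n m) : Prop :=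
  ∃ (v w : Fin n) (e f : Fin m), v ≠ w ∧ e ≠ f ∧
    (p = ({v, w}, {(v, w, e), (v, w, f)}) ∨ p = ({v, w}, {(v, w, e), (w, v, f)}))

/-- `LD(G)`: the loops and double edges that are subgraphs of the multigraph `G`. -/
def LD {n m : ℕ} (G : Multigraph n m) : Set (Part n m) :=
  {p | p.2 ⊆ G.edges ∧ (IsLoop p ∨ IsDoubleEdge p)}

/-- `P` is a patchwork with vertex set `Fin n` and edge labels `Fin m`: the unions of the vertex
sets and of the edge sets of its parts form a multigraph `MG(P)`, of which each part is a loop or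
a double edge. -/
def IsPatchwork {n m : ℕ} (P : Finset (Part n m)) : Prop :=
  ∃ MG : Multigraph n m, P.sup Prod.fst = Finset.univ ∧ P.sup Prod.snd = MG.edges ∧
    ∀ p ∈ P, p ∈ LD MG

open Classical in
/-- `P(z, w, u) = ∑_P u^{|P|} w^{m(P)} / (2^{m(P)} m(P)!) * z^{n(P)} / n(P)!` at a number `u`. -/
def patchworkGF (u : ℚ) : ℚ⟦X⟧⟦X⟧ :=
  PowerSeries.mk fun n => PowerSeries.mk fun m =>
    (∑ P : Finset (Part n m) with IsPatchwork P, u ^ P.card) / (2 ^ m * (m ! : ℚ) * (n ! : ℚ))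

/-- `P_ℓ(z, u)`, the generating function of patchworks of excess `ℓ`. -/
def patchworkPart (l : ℕ) (u : ℚ) : ℚ⟦X⟧ := excessPart (patchworkGF u) l

/-! ### The substitutions above are made at series without constant term -/

theorem constantCoeff_rootedTreeGF : PowerSeries.constantCoeff rootedTreeGF = 0 := by
  rw [← PowerSeries.coeff_zero_eq_constantCoeff_apply]
  have : {p : SimpleGraph (Fin 0) × Fin 0 | p.1.IsTree} = ∅ := by
    ext p; exact p.2.elim0
  simp [rootedTreeGF, this]

theorem constantCoeff_unicycleGF : PowerSeries.constantCoeff unicycleGF = 0 := by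
  rw [← PowerSeries.coeff_zero_eq_constantCoeff_apply]
  have : {G : SimpleGraph (Fin 0) | G ∈ unicycles 0 ∧ G.edgeSet.ncard = 0 + 0} = ∅ := by
    ext G
    simp only [unicycles, Set.mem_ofPred_eq, Set.mem_empty_iff_false, iff_false]
    rintro ⟨⟨h, -⟩, -⟩
    exact h.nonempty.some.elim0
  simp only [unicycleGF, excessPart, graphGF, PowerSeries.coeff_mk, this]
  simp

theorem constantCoeff_multiUnicycleGF : PowerSeries.constantCoeff multiUnicycleGF = 0 := by
  rw [← PowerSeries.coeff_zero_eq_constantCoeff_apply]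
  have : multiUnicycles 0 (0 + 0) = ∅ := by
    ext G
    simp only [multiUnicycles, Set.mem_ofPred_eq, Set.mem_empty_iff_false, iff_false]
    rintro ⟨h, -⟩
    exact h.nonempty.some.elim0
  simp only [multiUnicycleGF, excessPart, multigraphGF, PowerSeries.coeff_mk, this]
  simp

theorem hasSubst_rootedTree_mul (g : ℚ⟦X⟧) :
    PowerSeries.HasSubst (inZ rootedTreeGF * inX g : ℚ⟦X⟧⟦X⟧) := by
  apply PowerSeries.HasSubst.of_constantCoeff_zero'
  rw [map_mul, inZ, ← PowerSeries.coeff_zero_eq_constantCoeff_apply, PowerSeries.coeff_map,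
    PowerSeries.coeff_zero_eq_constantCoeff_apply, constantCoeff_rootedTreeGF]
  simp

end PosExcess

end

open scoped PowerSeries Nat

noncomputable section

namespace PosExcess

/-! ### Power series: Gaussian moments, the saddle point, extraction of positive excess. -/

section PowerSeriesIdentities

open PowerSeries Finset

/-! ### Linear differential equations and exponentials of power series -/

section General

variable {R : Type*} [CommRing R]

/-! Forgetting labels and orientations turns graphs and multigraphs into multiplicity functions on
`Sym2`, and the two families then differ only in the weight given to k copies of an edge. Weights
are multiplicative over components, so one exponential formula serves both
(`derivative_egf_totalFin`). It is used as F' = K' F, where K counts connected objects.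

All multigraphs have series ∑ e^{n²y/2} zⁿ/n!. Since e^{n²y/2} is the Gaussian moment of e^{nx}
(`gauss_rescale_exp`), this is the formal Gaussian integral of exp(z e^x). For simple graphs,
inclusion-exclusion over loops and double edges (`card_filter_isSimple`) inserts the patchwork
series at u = -1, evaluated at z e^x.

Put z = τ e^{-yτ}, that is τ = T(zy)/y with T = z e^T. Completing the square rewrites the total
series as e^{τ - τ²y/2} times the integral of exp(τ(e^x - 1 - x)) against the patchwork factor
(`saddleExp_mul_shiftSum`). The prefactor is the exponential of U(zy)/y with U = T - T²/2, which has
excess -1. In the integral, e^x - 1 - x = φ x²/2, so τ^j brings x^{2j}, hence y^j, and the moments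
resum to the powers (1 - Tφ)^{-(i+1/2)} (`coeff_invSqrtPow`). The integral H therefore contains only
nonnegative excesses, and its part of excess k is the closed formula without the factor e^{-V}.

Taking logarithms, the part of K of excess -1 is U and the rest is log H. Dropping excesses -1 and 0
and exponentiating leaves H e^{-V} (`excessPart_positive`). Reading off excess -1 for simple graphs
also identifies T with the series of rooted trees (`treeSeries_eq`). The inequality compares the
weights of each multiplicity function. -/

theorem eq_of_derivative_eq_mul [Algebra ℚ R] {F G H : R⟦X⟧}
    (hF : d⁄dX R F = H * F) (hG : d⁄dX R G = H * G)
    (h0 : constantCoeff F = constantCoeff G) : F = G := by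
  ext n
  induction n using Nat.strong_induction_on with
  | _ n ih =>
    cases n with
    | zero => simpa using h0
    | succ n =>
      -- The coefficient of index n of H * F only involves coefficients of F of index at most n,
      -- which are known by induction.
      have key : coeff n (d⁄dX R F) = coeff n (d⁄dX R G) := by
        rw [hF, hG, coeff_mul, coeff_mul]
        refine Finset.sum_congr rfl fun p hp => ?_
        rw [ih p.2 (by have := HasAntidiagonal.mem_antidiagonal.1 hp; omega)]
      rw [coeff_derivative, coeff_derivative] at key
      have h2 : (n + 1) • coeff (n + 1) F = (n + 1) • coeff (n + 1) G := by
        simpa [nsmul_eq_mul, mul_comm] using key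
      have : IsAddTorsionFree R := IsAddTorsionFree.of_module_rat R
      exact nsmul_right_injective (Nat.succ_ne_zero n) h2

theorem coeff_pow_eq_zero_of_lt {A : R⟦X⟧} (hA : constantCoeff A = 0) {n N : ℕ} (h : n < N) :
    coeff n (A ^ N) = 0 := by
  have h1 : (X : R⟦X⟧) ^ N ∣ A ^ N := pow_dvd_pow_of_dvd (X_dvd_iff.2 hA) N
  exact X_pow_dvd_iff.1 h1 n h

theorem coeff_subst_eq_sum {Q : Type*} [CommRing Q] [Algebra Q R] {A : R⟦X⟧}
    (hA : constantCoeff A = 0) (f : Q⟦X⟧) (n : ℕ) :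
    coeff n (f.subst A : R⟦X⟧) = ∑ N ∈ range (n + 1), coeff N f • coeff n (A ^ N) := by
  rw [coeff_subst' (HasSubst.of_constantCoeff_zero' hA)]
  refine finsum_eq_sum_of_support_subset _ fun N hN => ?_
  by_contra h
  refine hN ?_
  have : n < N := by simpa using h
  simp [coeff_pow_eq_zero_of_lt hA this]

theorem constantCoeff_subst_of_zero {Q : Type*} [CommRing Q] [Algebra Q R] {A : R⟦X⟧}
    (hA : constantCoeff A = 0) (f : Q⟦X⟧) :
    constantCoeff (f.subst A : R⟦X⟧) = algebraMap Q R (constantCoeff f) := by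
  rw [← coeff_zero_eq_constantCoeff_apply, coeff_subst_eq_sum hA]
  simp [Algebra.algebraMap_eq_smul_one]

theorem derivative_rescale (a : R) (f : R⟦X⟧) :
    d⁄dX R (rescale a f) = C a * rescale a (d⁄dX R f) := by
  ext n
  simp only [coeff_derivative, coeff_rescale, coeff_C_mul]
  ring

theorem derivative_C_mul (a : R) (f : R⟦X⟧) : d⁄dX R (C a * f) = C a * d⁄dX R f := by
  rw [Derivation.leibniz]; simp

theorem derivative_mul (f g : R⟦X⟧) : d⁄dX R (f * g) = d⁄dX R f * g + f * d⁄dX R g := by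
  rw [Derivation.leibniz, smul_eq_mul, smul_eq_mul]
  ring

/-- The exponential of a power series without constant term. -/
def expS [Algebra ℚ R] (A : R⟦X⟧) : R⟦X⟧ := (exp R).subst A

theorem derivative_expS [Algebra ℚ R] {A : R⟦X⟧} (hA : constantCoeff A = 0) :
    d⁄dX R (expS A) = d⁄dX R A * expS A := by
  rw [expS, derivative_subst (HasSubst.of_constantCoeff_zero' hA), derivative_exp, mul_comm]

theorem constantCoeff_expS [Algebra ℚ R] {A : R⟦X⟧} (hA : constantCoeff A = 0) :
    constantCoeff (expS A) = 1 := by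
  rw [expS, constantCoeff_subst_of_zero hA, constantCoeff_exp, map_one]

theorem derivative_rescale_exp [Algebra ℚ R] (a : R) :
    d⁄dX R (rescale a (exp R)) = C a * rescale a (exp R) := by
  rw [derivative_rescale, derivative_exp]

/-- The sum `∑ X ^ b * N b`. -/
def shiftSum (N : ℕ → R⟦X⟧) : R⟦X⟧ :=
  mk fun j => ∑ p ∈ antidiagonal j, coeff p.2 (N p.1)

theorem coeff_shiftSum (N : ℕ → R⟦X⟧) (j : ℕ) :
    coeff j (shiftSum N) = ∑ p ∈ antidiagonal j, coeff p.2 (N p.1) := coeff_mk _ _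

theorem mul_shiftSum (e : R⟦X⟧) (N : ℕ → R⟦X⟧) :
    e * shiftSum N = shiftSum fun b => e * N b := by
  ext j
  simp only [coeff_mul, coeff_shiftSum, Finset.mul_sum]
  rw [Finset.sum_sigma', Finset.sum_sigma']
  refine Finset.sum_nbij' (fun s => ⟨(s.2.1, s.1.1 + s.2.2), (s.1.1, s.2.2)⟩)
    (fun s => ⟨(s.2.1, s.1.1 + s.2.2), (s.1.1, s.2.2)⟩) ?_ ?_ ?_ ?_ ?_
  all_goals
    simp only [mem_sigma, HasAntidiagonal.mem_antidiagonal, Sigma.forall, Prod.forall]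
    rintro a b c d ⟨h1, h2⟩
    try subst h2
    try subst h1
  · exact ⟨by omega, trivial⟩
  · exact ⟨by omega, trivial⟩
  · rfl
  · rfl
  · trivial

theorem shiftSum_shiftSum (N : ℕ → ℕ → R⟦X⟧) :
    shiftSum (fun a => shiftSum (N a)) =
      shiftSum fun n => ∑ p ∈ antidiagonal n, N p.1 p.2 := by
  ext j
  simp only [coeff_shiftSum, map_sum]
  rw [Finset.sum_sigma', Finset.sum_sigma']
  refine Finset.sum_nbij' (fun s => ⟨(s.1.1 + s.2.1, s.2.2), (s.1.1, s.2.1)⟩)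
    (fun s => ⟨(s.2.1, s.2.2 + s.1.2), (s.2.2, s.1.2)⟩) ?_ ?_ ?_ ?_ ?_
  all_goals
    simp only [mem_sigma, HasAntidiagonal.mem_antidiagonal, Sigma.forall, Prod.forall]
    rintro a b c d ⟨h1, h2⟩
    try subst h2
    try subst h1
  · exact ⟨by omega, trivial⟩
  · exact ⟨by omega, trivial⟩
  · rfl
  · rfl
  · trivial

theorem shiftSum_congr {N M : ℕ → R⟦X⟧} (h : ∀ b, N b = M b) : shiftSum N = shiftSum M := by
  rw [funext h]

theorem subst_X_mul_eq_shiftSum (e : R⟦X⟧) (F : R⟦X⟧) :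
    F.subst (X * e) = shiftSum fun n => C (coeff n F) * e ^ n := by
  ext j
  rw [coeff_subst_eq_sum (by simp), coeff_shiftSum,
    Finset.Nat.sum_antidiagonal_eq_sum_range_succ (fun a b => coeff b (C (coeff a F) * e ^ a))]
  refine Finset.sum_congr rfl fun n hn => ?_
  rw [mul_pow, mul_comm, coeff_mul_X_pow', if_pos (by simpa [Nat.lt_succ_iff] using hn),
    coeff_C_mul, smul_eq_mul]

end General

/-! ### The formal Gaussian integral -/

/-- The formal Gaussian moment functional `x ^ (2i) ↦ (2i-1)!! y ^ i`. -/
def gauss : ℚ⟦X⟧ →ₗ[ℚ] ℚ⟦X⟧ where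
  toFun f := mk fun i => oddDoubleFactorial i * coeff (2 * i) f
  map_add' f g := by ext; simp [mul_add]
  map_smul' c f := by ext; simp; ring

theorem coeff_gauss (f : ℚ⟦X⟧) (i : ℕ) :
    coeff i (gauss f) = oddDoubleFactorial i * coeff (2 * i) f :=
  coeff_mk i fun i => oddDoubleFactorial i * coeff (2 * i) f

theorem oddDoubleFactorial_succ (i : ℕ) :
    oddDoubleFactorial (i + 1) = (2 * i + 1) * oddDoubleFactorial i := by
  have h1 : (i ! : ℚ) ≠ 0 := by exact_mod_cast Nat.factorial_ne_zero _
  have h2 : (2 * (i + 1))! = (2 * i + 2) * ((2 * i + 1) * (2 * i)!) := by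
    rw [show 2 * (i + 1) = (2 * i + 1) + 1 by ring, Nat.factorial_succ, Nat.factorial_succ]
  have h3 : (i : ℚ) + 1 ≠ 0 := by positivity
  rw [oddDoubleFactorial, oddDoubleFactorial, h2, Nat.factorial_succ]
  push_cast
  field_simp
  ring

/-- Gaussian integration by parts with variance y, equivalent to the recurrence (2i+1)!! = (2i+1)
(2i-1)!!. -/
theorem gauss_X_mul (h : ℚ⟦X⟧) : gauss (X * h) = X * gauss (d⁄dX ℚ h) := by
  ext i
  cases i with
  | zero => simp [coeff_gauss]
  | succ i =>
    rw [coeff_gauss, show 2 * (i + 1) = (2 * i + 1) + 1 by ring, coeff_succ_X_mul,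
      coeff_succ_X_mul, coeff_gauss, coeff_derivative, oddDoubleFactorial_succ]
    push_cast
    ring

/-- `e ^ (n² y / 2)`. -/
def gaussExp (n : ℕ) : ℚ⟦X⟧ := rescale ((n : ℚ) ^ 2 / 2) (exp ℚ)

/-- Moment generating function of a Gaussian of variance y, from (2i-1)!!/(2i)! = 1/(2^i i!). It
links the integral to e^{n²y/2}, the series of all multigraphs on n vertices. -/
theorem gauss_rescale_exp (n : ℕ) : gauss (rescale (n : ℚ) (exp ℚ)) = gaussExp n := by
  ext i
  have h1 : ((2 * i)! : ℚ) ≠ 0 := by exact_mod_cast Nat.factorial_ne_zero _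
  rw [coeff_gauss, gaussExp, coeff_rescale, coeff_rescale, coeff_exp, coeff_exp,
    oddDoubleFactorial, div_pow, ← pow_mul]
  simp
  field_simp

/-- The moment functional applied to the inner variable of a bivariate series. -/
def gaussHat (M : ℚ⟦X⟧⟦X⟧) : ℚ⟦X⟧⟦X⟧ := mk fun n => gauss (coeff n M)

theorem coeff_gaussHat (M : ℚ⟦X⟧⟦X⟧) (n : ℕ) : coeff n (gaussHat M) = gauss (coeff n M) :=
  coeff_mk _ _

theorem gauss_C_mul (c : ℚ) (f : ℚ⟦X⟧) : gauss (C c * f) = C c * gauss f := by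
  rw [← smul_eq_C_mul, ← smul_eq_C_mul, map_smul]

theorem gaussHat_inZ_mul (f : ℚ⟦X⟧) (M : ℚ⟦X⟧⟦X⟧) :
    gaussHat (inZ f * M) = inZ f * gaussHat M := by
  ext1 n
  simp only [coeff_gaussHat, coeff_mul, map_sum, inZ, coeff_map, gauss_C_mul]

theorem inZ_exp : inZ (exp ℚ) = exp ℚ⟦X⟧ := map_exp _

theorem coeff_rescale_exp {R : Type*} [CommRing R] [Algebra ℚ R] (s : R) (j : ℕ) :
    coeff j (rescale s (exp R)) = (1 / (j ! : ℚ)) • s ^ j := by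
  rw [coeff_rescale, coeff_exp, Algebra.smul_def, mul_comm]

/-- `exp(-τ x) e^{n x}`. -/
def tilt (n : ℕ) : ℚ⟦X⟧⟦X⟧ := rescale (-X : ℚ⟦X⟧) (exp ℚ⟦X⟧) * C (rescale (n : ℚ) (exp ℚ))

theorem coeff_tilt (n j : ℕ) :
    coeff j (tilt n) = (1 / (j ! : ℚ)) • ((-X) ^ j * rescale (n : ℚ) (exp ℚ)) := by
  rw [tilt, coeff_mul_C, coeff_rescale_exp, smul_mul_assoc]

/-- Differentiating in τ brings down -x. Integration by parts replaces x by y d/dx, which acts on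
e^{(n-τ)x} as multiplication by y(n-τ). -/
theorem gaussHat_tilt_derivative (n : ℕ) :
    d⁄dX ℚ⟦X⟧ (gaussHat (tilt n)) =
      (C (X : ℚ⟦X⟧) * X - C ((n : ℚ⟦X⟧) * X)) * gaussHat (tilt n) := by
  have hd : d⁄dX ℚ (rescale (n : ℚ) (exp ℚ)) = (n : ℚ) • rescale (n : ℚ) (exp ℚ) := by
    rw [derivative_rescale_exp, smul_eq_C_mul]
  ext1 j
  have hj : (j ! : ℚ) ≠ 0 := by exact_mod_cast Nat.factorial_ne_zero _
  have hj1 : (j : ℚ) + 1 ≠ 0 := by positivity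
  -- The factor j+1 from the derivative reduces 1/(j+1)! to 1/j!, and one factor -x is split off for
  -- the integration by parts.
  have step : coeff j (d⁄dX ℚ⟦X⟧ (gaussHat (tilt n))) =
      -((1 / (j ! : ℚ)) • (X * gauss (d⁄dX ℚ ((-X) ^ j * rescale (n : ℚ) (exp ℚ))))) := by
    rw [coeff_derivative, coeff_gaussHat, coeff_tilt, map_smul, ← gauss_X_mul,
      show (-X : ℚ⟦X⟧) ^ (j + 1) * rescale (n : ℚ) (exp ℚ) =
        -(X * ((-X) ^ j * rescale (n : ℚ) (exp ℚ))) by ring, map_neg, smul_neg, neg_mul]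
    congr 1
    rw [show ((j : ℚ⟦X⟧) + 1) = C ((j : ℚ) + 1) by simp, mul_comm, ← smul_eq_C_mul, smul_smul,
      Nat.factorial_succ]
    congr 1
    push_cast
    field_simp
  rw [step, sub_mul, map_sub, mul_assoc, coeff_C_mul, coeff_C_mul, coeff_gaussHat, coeff_tilt,
    map_smul]
  cases j with
  | zero =>
    rw [coeff_zero_X_mul, pow_zero, one_mul, hd, map_smul]
    simp only [smul_eq_C_mul, map_natCast]
    ring
  | succ j =>
    have hj : (j ! : ℚ) ≠ 0 := by exact_mod_cast Nat.factorial_ne_zero _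
    have hj1 : (j : ℚ) + 1 ≠ 0 := by positivity
    rw [coeff_succ_X_mul, coeff_gaussHat, coeff_tilt, map_smul]
    have e1 : d⁄dX ℚ ((-X : ℚ⟦X⟧) ^ (j + 1) * rescale (n : ℚ) (exp ℚ)) =
        (n : ℚ) • ((-X) ^ (j + 1) * rescale (n : ℚ) (exp ℚ)) -
          ((j : ℚ) + 1) • ((-X) ^ j * rescale (n : ℚ) (exp ℚ)) := by
      rw [Derivation.leibniz, hd, derivative_pow]
      simp only [smul_eq_C_mul, smul_eq_mul, map_natCast, map_neg, derivative_X, map_add, map_one,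
        Nat.add_sub_cancel]
      push_cast
      ring
    rw [e1, map_sub, map_smul, map_smul, Nat.factorial_succ]
    generalize gauss ((-X) ^ j * rescale (n : ℚ) (exp ℚ)) = u
    generalize gauss ((-X) ^ (j + 1) * rescale (n : ℚ) (exp ℚ)) = v
    simp only [smul_eq_C_mul]
    have e3 : (C (1 / ((((j + 1) * j ! : ℕ)) : ℚ)) : ℚ⟦X⟧) * C ((j : ℚ) + 1) =
        C (1 / (j ! : ℚ)) := by
      rw [← map_mul]
      congr 1
      push_cast
      field_simp
    rw [← e3]
    simp only [map_natCast]
    ring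

/-- `exp(τ - τ² y / 2)`. -/
def saddleExp : ℚ⟦X⟧⟦X⟧ := expS (X - C (C (1 / 2 : ℚ) * X) * X ^ 2)

theorem derivative_saddleExp :
    d⁄dX ℚ⟦X⟧ saddleExp = (1 - C (X : ℚ⟦X⟧) * X) * saddleExp := by
  have h : d⁄dX ℚ⟦X⟧ (X - C (C (1 / 2 : ℚ) * X) * X ^ 2) = 1 - C (X : ℚ⟦X⟧) * X := by
    rw [map_sub, derivative_X, derivative_C_mul, derivative_pow, derivative_X]
    have : (C (C (1 / 2 : ℚ) * X : ℚ⟦X⟧) : ℚ⟦X⟧⟦X⟧) * 2 = C X := by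
      rw [show (2 : ℚ⟦X⟧⟦X⟧) = C (C 2) from (map_ofNat (C.comp C) 2).symm, ← map_mul,
        mul_right_comm, ← map_mul]
      norm_num
    rw [← this]
    push_cast
    ring
  rw [saddleExp, derivative_expS (by simp), h]

theorem constantCoeff_saddleExp : constantCoeff saddleExp = 1 :=
  constantCoeff_expS (by simp)

/-- `exp(-τ² y / 2)`. -/
def varianceExp : ℚ⟦X⟧⟦X⟧ := expS (-(C (C (1 / 2 : ℚ) * X) * X ^ 2))

theorem derivative_varianceExp :
    d⁄dX ℚ⟦X⟧ varianceExp = -(C (X : ℚ⟦X⟧) * X) * varianceExp := by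
  have h : d⁄dX ℚ⟦X⟧ (-(C (C (1 / 2 : ℚ) * X) * X ^ 2)) = -(C (X : ℚ⟦X⟧) * X) := by
    rw [map_neg, derivative_C_mul, derivative_pow, derivative_X]
    have : (C (C (1 / 2 : ℚ) * X : ℚ⟦X⟧) : ℚ⟦X⟧⟦X⟧) * 2 = C X := by
      rw [show (2 : ℚ⟦X⟧⟦X⟧) = C (C 2) from (map_ofNat (C.comp C) 2).symm, ← map_mul,
        mul_right_comm, ← map_mul]
      norm_num
    rw [← this]
    push_cast
    ring
  rw [varianceExp, derivative_expS (by simp), h]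

theorem constantCoeff_varianceExp : constantCoeff varianceExp = 1 :=
  constantCoeff_expS (by simp)

theorem saddleExp_eq : saddleExp = exp ℚ⟦X⟧ * varianceExp := by
  refine eq_of_derivative_eq_mul derivative_saddleExp ?_ ?_
  · rw [derivative_mul, derivative_varianceExp, derivative_exp]
    ring
  · rw [map_mul, constantCoeff_saddleExp, constantCoeff_varianceExp, constantCoeff_exp, one_mul]

/-- Completing the square: the moment of e^{(n-τ)x} is e^{(n-τ)²y/2}. Both sides solve F' = -ny F in
τ and equal e^{n²y/2} at τ = 0. -/
theorem varianceExp_mul_gaussHat_tilt (n : ℕ) :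
    varianceExp * gaussHat (tilt n) =
      C (gaussExp n) * rescale (-((n : ℚ⟦X⟧) * X)) (exp ℚ⟦X⟧) := by
  refine eq_of_derivative_eq_mul (H := -C ((n : ℚ⟦X⟧) * X)) ?_ ?_ ?_
  · rw [derivative_mul, derivative_varianceExp, gaussHat_tilt_derivative]
    ring
  · rw [derivative_C_mul, derivative_rescale_exp, map_neg]
    ring
  · rw [map_mul, map_mul, constantCoeff_varianceExp, one_mul,
      ← coeff_zero_eq_constantCoeff_apply, coeff_gaussHat, coeff_tilt,
      ← coeff_zero_eq_constantCoeff_apply (rescale _ _), coeff_rescale_exp]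
    simp [gauss_rescale_exp]

/-- `∫ exp(τ (e ^ x - 1 - x)) e ^ (a x)` for the formal Gaussian integral. -/
def saddleIntegral (a : ℕ) : ℚ⟦X⟧⟦X⟧ :=
  gaussHat (rescale (exp ℚ - 1 - X : ℚ⟦X⟧) (exp ℚ⟦X⟧) * C (rescale (a : ℚ) (exp ℚ)))

theorem exp_mul_rescale_saddle :
    exp ℚ⟦X⟧ * rescale (exp ℚ - 1 - X : ℚ⟦X⟧) (exp ℚ⟦X⟧) =
      rescale (exp ℚ) (exp ℚ⟦X⟧) * rescale (-X : ℚ⟦X⟧) (exp ℚ⟦X⟧) := by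
  nth_rewrite 1 [show exp ℚ⟦X⟧ = rescale (1 : ℚ⟦X⟧) (exp ℚ⟦X⟧) by simp]
  rw [exp_mul_exp_eq_exp_add, exp_mul_exp_eq_exp_add]
  congr 2
  ring

/-- Expanding exp(τ e^x) = ∑ τ^b e^{bx}/b!, each factor e^{bx} raises the tilt from a to a + b. -/
theorem gaussHat_exp_mul_tilt (a : ℕ) :
    gaussHat (rescale (exp ℚ) (exp ℚ⟦X⟧) * tilt a) =
      shiftSum fun b => C (C (1 / (b ! : ℚ))) * gaussHat (tilt (a + b)) := by
  ext1 j
  rw [coeff_gaussHat, coeff_mul, map_sum, coeff_shiftSum]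
  refine Finset.sum_congr rfl fun p _ => ?_
  rw [coeff_C_mul, coeff_gaussHat, ← gauss_C_mul, coeff_tilt, coeff_tilt, coeff_rescale_exp,
    exp_pow_eq_rescale_exp]
  congr 1
  have : (rescale ((a + p.1 : ℕ) : ℚ) (exp ℚ)) = rescale (a : ℚ) (exp ℚ) *
      rescale (p.1 : ℚ) (exp ℚ) := by
    rw [exp_mul_exp_eq_exp_add]; push_cast; rfl
  rw [this]
  simp only [smul_eq_C_mul]
  ring

/-- The factor e^τ turns exp(τ(e^x - 1 - x)) back into exp(τ e^x) e^{-τx}, and e^{-τ²y/2} cancels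
the square left by the tilt. -/
theorem saddleExp_mul_saddleIntegral (a : ℕ) :
    saddleExp * saddleIntegral a = shiftSum fun b => C (C (1 / (b ! : ℚ)) * gaussExp (a + b)) *
      rescale (-(((a + b : ℕ) : ℚ⟦X⟧) * X)) (exp ℚ⟦X⟧) := by
  have h1 : exp ℚ⟦X⟧ * saddleIntegral a =
      gaussHat (rescale (exp ℚ) (exp ℚ⟦X⟧) * tilt a) := by
    rw [saddleIntegral, ← inZ_exp, ← gaussHat_inZ_mul, inZ_exp, ← mul_assoc,
      exp_mul_rescale_saddle, mul_assoc, tilt]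
  rw [saddleExp_eq, mul_right_comm, h1, gaussHat_exp_mul_tilt, mul_comm, mul_shiftSum]
  refine shiftSum_congr fun b => ?_
  rw [mul_left_comm, varianceExp_mul_gaussHat_tilt, map_mul, mul_assoc]

/-- The saddle point identity for the formal Gaussian integral. -/
theorem saddleExp_mul_shiftSum (p : ℕ → ℚ⟦X⟧) :
    saddleExp * shiftSum (fun a => C (p a) * saddleIntegral a) =
      (mk fun n => (∑ q ∈ antidiagonal n, p q.1 * C (1 / (q.2 ! : ℚ))) * gaussExp n : ℚ⟦X⟧⟦X⟧).subst
        (X * rescale (-X : ℚ⟦X⟧) (exp ℚ⟦X⟧)) := by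
  rw [mul_shiftSum, subst_X_mul_eq_shiftSum]
  have h : ∀ a, saddleExp * (C (p a) * saddleIntegral a) = shiftSum fun b =>
      C (p a) * (C (C (1 / (b ! : ℚ)) * gaussExp (a + b)) *
        rescale (-(((a + b : ℕ) : ℚ⟦X⟧) * X)) (exp ℚ⟦X⟧)) := fun a => by
    rw [mul_left_comm, saddleExp_mul_saddleIntegral, mul_shiftSum]
  rw [shiftSum_congr h, shiftSum_shiftSum]
  refine shiftSum_congr fun n => ?_
  -- With n = a + b, the common factor τⁿ e^{-nyτ} is the n-th power of the substituted series τ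
  -- e^{-yτ}.
  rw [coeff_mk, ← map_pow, exp_pow_eq_rescale_exp, rescale_rescale, mul_neg, Finset.sum_mul,
    map_sum, Finset.sum_mul]
  refine Finset.sum_congr rfl fun q hq => ?_
  rw [HasAntidiagonal.mem_antidiagonal.1 hq]
  simp only [map_mul]
  ring

/-! ### Substitution in a power series with coefficients in the same ring -/

section SubstSelf

variable {R : Type*} [CommRing R]

/-- `M(A)`, for series `M` and `A` over the same ring. -/
def substSelf (A M : R⟦X⟧) : R⟦X⟧ := M.subst A

theorem coeff_substSelf {A : R⟦X⟧} (hA : constantCoeff A = 0) (M : R⟦X⟧) (n : ℕ) :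
    coeff n (substSelf A M) = ∑ N ∈ range (n + 1), coeff N M * coeff n (A ^ N) :=
  coeff_subst_eq_sum hA M n

theorem substSelf_mul {A : R⟦X⟧} (hA : constantCoeff A = 0) (M N : R⟦X⟧) :
    substSelf A (M * N) = substSelf A M * substSelf A N :=
  subst_mul (HasSubst.of_constantCoeff_zero' hA) M N

theorem substSelf_sub {A : R⟦X⟧} (hA : constantCoeff A = 0) (M N : R⟦X⟧) :
    substSelf A (M - N) = substSelf A M - substSelf A N :=
  subst_sub (HasSubst.of_constantCoeff_zero' hA) M N

theorem substSelf_X {A : R⟦X⟧} (hA : constantCoeff A = 0) : substSelf A X = A :=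
  subst_X (HasSubst.of_constantCoeff_zero' hA)

theorem substSelf_C (A : R⟦X⟧) (c : R) : substSelf A (C c) = C c := subst_C c

theorem substSelf_one (A : R⟦X⟧) : substSelf A 1 = 1 := by
  rw [← map_one (C (R := R)), substSelf_C]

theorem X_substSelf (M : R⟦X⟧) : substSelf X M = M := X_subst M

theorem constantCoeff_substSelf {A : R⟦X⟧} (hA : constantCoeff A = 0) (M : R⟦X⟧) :
    constantCoeff (substSelf A M) = constantCoeff M :=
  constantCoeff_subst_of_zero hA M

theorem substSelf_substSelf {A B : R⟦X⟧} (hA : constantCoeff A = 0) (hB : constantCoeff B = 0)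
    (M : R⟦X⟧) : substSelf B (substSelf A M) = substSelf (substSelf B A) M :=
  subst_comp_subst_apply (HasSubst.of_constantCoeff_zero' hA)
    (HasSubst.of_constantCoeff_zero' hB) M

theorem derivative_substSelf {A : R⟦X⟧} (hA : constantCoeff A = 0) (M : R⟦X⟧) :
    d⁄dX R (substSelf A M) = substSelf A (d⁄dX R M) * d⁄dX R A :=
  derivative_subst (HasSubst.of_constantCoeff_zero' hA)

theorem substSelf_rescale {A : R⟦X⟧} (hA : constantCoeff A = 0) (c : R) (M : R⟦X⟧) :
    substSelf A (rescale c M) = substSelf (C c * A) M := by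
  ext n
  rw [coeff_substSelf hA, coeff_substSelf (by simp [hA])]
  refine Finset.sum_congr rfl fun N _ => ?_
  rw [mul_pow, ← map_pow, coeff_C_mul, coeff_rescale]
  ring

theorem constantCoeff_rescale (c : R) (A : R⟦X⟧) :
    constantCoeff (rescale c A) = constantCoeff A := by
  rw [← coeff_zero_eq_constantCoeff_apply, coeff_rescale, pow_zero, one_mul,
    coeff_zero_eq_constantCoeff_apply]

theorem rescale_substSelf {A : R⟦X⟧} (hA : constantCoeff A = 0) (c : R) (M : R⟦X⟧) :
    substSelf (rescale c A) M = rescale c (substSelf A M) := by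
  ext n
  rw [coeff_rescale, coeff_substSelf hA,
    coeff_substSelf (by rw [constantCoeff_rescale, hA]), Finset.mul_sum]
  refine Finset.sum_congr rfl fun N _ => ?_
  rw [← map_pow, coeff_rescale]
  ring

end SubstSelf

/-! ### Series in `z` seen as bivariate series -/

theorem coeff_inZ (f : ℚ⟦X⟧) (n : ℕ) : coeff n (inZ f) = C (coeff n f) := coeff_map _ _ _

theorem inZ_mul (f g : ℚ⟦X⟧) : inZ (f * g) = inZ f * inZ g := map_mul _ _ _

theorem inZ_pow (f : ℚ⟦X⟧) (n : ℕ) : inZ (f ^ n) = inZ f ^ n := map_pow _ _ _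

theorem inZ_sub (f g : ℚ⟦X⟧) : inZ (f - g) = inZ f - inZ g := map_sub _ _ _

theorem inZ_neg (f : ℚ⟦X⟧) : inZ (-f) = -inZ f := map_neg _ _

theorem constantCoeff_inZ {f : ℚ⟦X⟧} (hf : constantCoeff f = 0) : constantCoeff (inZ f) = 0 := by
  rw [← coeff_zero_eq_constantCoeff_apply, coeff_inZ, coeff_zero_eq_constantCoeff_apply, hf,
    map_zero]

theorem derivative_inZ (f : ℚ⟦X⟧) : d⁄dX ℚ⟦X⟧ (inZ f) = inZ (d⁄dX ℚ f) := by
  ext1 n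
  rw [coeff_derivative, coeff_inZ, coeff_inZ, coeff_derivative]
  simp

theorem substSelf_inZ {A : ℚ⟦X⟧} (hA : constantCoeff A = 0) (f : ℚ⟦X⟧) :
    substSelf (inZ A) (inZ f) = inZ (substSelf A f) := by
  ext1 n
  rw [coeff_substSelf (constantCoeff_inZ hA), coeff_inZ, coeff_substSelf hA, map_sum]
  refine Finset.sum_congr rfl fun N _ => ?_
  rw [coeff_inZ, ← inZ_pow, coeff_inZ, map_mul]

theorem coeff_coeffX (d n : ℕ) (F : ℚ⟦X⟧⟦X⟧) : coeff n (coeffX d F) = coeff d (coeff n F) :=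
  coeff_mk n fun n => coeff d (coeff n F)

theorem coeff_excessPart (k n : ℕ) (F : ℚ⟦X⟧⟦X⟧) :
    coeff n (excessPart F k) = coeff (n + k) (coeff n F) :=
  coeff_mk n fun n => coeff (n + k) (coeff n F)

theorem coeffX_mul_inZ (d : ℕ) (F : ℚ⟦X⟧⟦X⟧) (f : ℚ⟦X⟧) :
    coeffX d (F * inZ f) = coeffX d F * f := by
  ext n
  rw [coeff_coeffX, coeff_mul, coeff_mul, map_sum]
  exact Finset.sum_congr rfl fun p _ => by rw [coeff_inZ, coeff_mul_C, coeff_coeffX]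

theorem coeffX_substSelf_inZ {A : ℚ⟦X⟧} (hA : constantCoeff A = 0) (d : ℕ) (M : ℚ⟦X⟧⟦X⟧) :
    coeffX d (substSelf (inZ A) M) = substSelf A (coeffX d M) := by
  ext n
  rw [coeff_coeffX, coeff_substSelf (constantCoeff_inZ hA), coeff_substSelf hA, map_sum]
  refine Finset.sum_congr rfl fun N _ => ?_
  rw [← inZ_pow, coeff_inZ, coeff_mul_C, coeff_coeffX]

/-- `rescale X` replaces z by zw, so the inner exponent of G is the excess m - n. A series of this
form has no negative excess. -/
theorem excessPart_rescale (G : ℚ⟦X⟧⟦X⟧) (k : ℕ) :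
    excessPart (rescale X G) k = coeffX k G := by
  ext n
  rw [coeff_excessPart, coeff_coeffX, coeff_rescale, add_comm n k, coeff_X_pow_mul]

/-- Separates f(T(z) g(x)) into a series in a free variable T and x, followed by the substitution T
= T(z). The closed formula can then be handled before the tree series enters. -/
theorem comp_inZ_mul_inX {T : ℚ⟦X⟧} (hT : constantCoeff T = 0) (f g : ℚ⟦X⟧) :
    comp f (inZ T * inX g) = substSelf (inZ T) (rescale g (inZ f)) := by
  ext1 n
  rw [comp, coeff_subst_eq_sum (by rw [map_mul, constantCoeff_inZ hT, zero_mul]),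
    coeff_substSelf (constantCoeff_inZ hT)]
  refine Finset.sum_congr rfl fun N _ => ?_
  rw [mul_pow, inX, ← map_pow, coeff_mul_C, coeff_rescale, coeff_inZ, smul_eq_C_mul]
  ring

/-- The series `(1 - u) ^ (-(i + 1/2))`. -/
def invSqrtPow (i : ℕ) : ℚ⟦X⟧ := rescale (-1) (binomialSeries ℚ (-((i : ℚ) + 1 / 2)))

theorem invOneSubRPow_inZ_mul_inX {T : ℚ⟦X⟧} (hT : constantCoeff T = 0) (g : ℚ⟦X⟧) (i : ℕ) :
    invOneSubRPow (inZ T * inX g) ((i : ℚ) + 1 / 2) =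
      substSelf (inZ T) (rescale g (inZ (invSqrtPow i))) := by
  have h : -(inZ T * inX g) = inZ T * inX (-g) := by
    rw [inX, inX, map_neg, mul_neg]
  rw [invOneSubRPow, h, comp_inZ_mul_inX hT]
  congr 1
  ext1 n
  rw [coeff_rescale, coeff_rescale, coeff_inZ, coeff_inZ, invSqrtPow, coeff_rescale, map_mul,
    neg_pow]
  simp
  ring

/-- The quotient (2(i+j)-1)!!/(2i-1)!! is 2^j (i+1/2)(i+3/2)⋯(i+j-1/2). This is why higher Gaussian
moments resum to a half-integer power. -/
theorem coeff_invSqrtPow (i j : ℕ) : oddDoubleFactorial i * coeff j (invSqrtPow i) =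
    oddDoubleFactorial (i + j) / (2 ^ j * (j ! : ℚ)) := by
  rw [invSqrtPow, coeff_rescale, binomialSeries_coeff, smul_eq_mul, mul_one]
  have key : ((j ! : ℕ) : ℚ) * Ring.choose (-((i : ℚ) + 1 / 2)) j =
      (-1) ^ j * (oddDoubleFactorial (i + j) / (2 ^ j * oddDoubleFactorial i)) := by
    rw [← nsmul_eq_mul, ← Ring.descPochhammer_eq_factorial_smul_choose]
    have hi : oddDoubleFactorial i ≠ 0 := by
      rw [oddDoubleFactorial]; positivity
    induction j with
    | zero => simp [hi]
    | succ j ih =>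
      rw [descPochhammer_succ_right, Polynomial.smeval_mul, ih, ← add_assoc,
        oddDoubleFactorial_succ]
      simp [Polynomial.smeval_sub, Polynomial.smeval_X, Polynomial.smeval_natCast]
      field_simp
      ring
  have hj : (j ! : ℚ) ≠ 0 := by exact_mod_cast Nat.factorial_ne_zero _
  have hi : oddDoubleFactorial i ≠ 0 := by
    rw [oddDoubleFactorial]; positivity
  have key2 : Ring.choose (-((i : ℚ) + 1 / 2)) j =
      (-1) ^ j * (oddDoubleFactorial (i + j) / (2 ^ j * oddDoubleFactorial i)) / (j ! : ℚ) := by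
    rw [eq_div_iff hj, ← key]; ring
  rw [key2]
  field_simp
  rw [← pow_mul, mul_comm j 2, pow_mul]
  norm_num

/-! ### The closed formula before substitution of the tree series -/

section ClosedForm

variable (P : ℕ → ℚ⟦X⟧)

/-- The integrand `P_l(T e ^ x) (1 - T φ(x)) ^ (-(i + 1/2))`, as a series in `T` and `x`. -/
def integrand (l i : ℕ) : ℚ⟦X⟧⟦X⟧ :=
  rescale (exp ℚ) (inZ (P l)) * rescale phi (inZ (invSqrtPow i))

/-- The closed formula of excess `k`, as a series in `T`. -/
def closedForm (k : ℕ) : ℚ⟦X⟧ :=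
  ∑ l ∈ range (k + 1),
    oddDoubleFactorial (k - l) • coeffX (2 * (k - l)) (integrand P l (k - l))

/-- All the closed formulas, as a series in `T` and `y`. -/
def closedFormGF : ℚ⟦X⟧⟦X⟧ := PowerSeries.mk fun N => PowerSeries.mk fun k => coeff N (closedForm P k)

theorem coeffX_closedFormGF (k : ℕ) : coeffX k (closedFormGF P) = closedForm P k := by
  ext N
  rw [coeff_coeffX, closedFormGF, coeff_mk, coeff_mk]

/-- The coefficient of `u ^ a` in `∑ y ^ (a + l) P_l(u)`. -/
def weightedPart (a : ℕ) : ℚ⟦X⟧ := X ^ a * PowerSeries.mk fun l => coeff a (P l)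

theorem gauss_X_pow_mul (j : ℕ) (f : ℚ⟦X⟧) :
    gauss (X ^ (2 * j) * f) =
      X ^ j * PowerSeries.mk fun i => oddDoubleFactorial (i + j) * coeff (2 * i) f := by
  ext m
  rw [coeff_gauss, coeff_X_pow_mul', coeff_X_pow_mul']
  by_cases h : j ≤ m
  · rw [if_pos (by omega), if_pos h, coeff_mk, Nat.sub_add_cancel h, Nat.mul_sub]
  · rw [if_neg (by omega), if_neg h, mul_zero]

/-- As e^x - 1 - x = φ x²/2, the coefficient of τ^j contains x^{2j}. It produces y^j and raises the
moments from order 2i to 2(i+j), which `coeff_invSqrtPow` absorbs. -/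
theorem coeff_saddleIntegral (a j : ℕ) : coeff j (saddleIntegral a) =
    X ^ j * PowerSeries.mk fun i => oddDoubleFactorial i * coeff j (invSqrtPow i) *
      coeff (2 * i) (exp ℚ ^ a * phi ^ j) := by
  have h : (1 / (j ! : ℚ)) • (exp ℚ - 1 - X : ℚ⟦X⟧) ^ j * rescale (a : ℚ) (exp ℚ) =
      (1 / (2 ^ j * (j ! : ℚ))) • (X ^ (2 * j) * (exp ℚ ^ a * phi ^ j)) := by
    have hj : (j ! : ℚ) ≠ 0 := by exact_mod_cast Nat.factorial_ne_zero _
    rw [← phi_mul, mul_pow, mul_pow, ← map_pow, ← pow_mul, smul_eq_C_mul, smul_eq_C_mul,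
      exp_pow_eq_rescale_exp, show (1 / (2 ^ j * (j ! : ℚ))) = 1 / (j ! : ℚ) * (1 / 2) ^ j by
        field_simp; rw [← mul_pow]; norm_num, map_mul]
    ring
  rw [saddleIntegral, coeff_gaussHat, coeff_mul_C, coeff_rescale_exp, h, map_smul,
    gauss_X_pow_mul, ← mul_smul_comm]
  congr 1
  ext i
  rw [coeff_smul, coeff_mk, coeff_mk, coeff_invSqrtPow, smul_eq_mul]
  ring

/-- The patchwork factor gives y^a with τ^a and the integral gives y^j with τ^j, so τ^N always comes
with y^N. What remains is a series in τy and y, which becomes a series in T(zy) and y. -/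
theorem shiftSum_saddleIntegral :
    shiftSum (fun a => C (weightedPart P a) * saddleIntegral a) =
      rescale X (closedFormGF P) := by
  ext1 N
  rw [coeff_shiftSum, coeff_rescale]
  have h : ∀ p ∈ antidiagonal N, coeff p.2 (C (weightedPart P p.1) * saddleIntegral p.1) =
      X ^ N * ((PowerSeries.mk fun l => coeff p.1 (P l)) * PowerSeries.mk fun i =>
        oddDoubleFactorial i * coeff p.2 (invSqrtPow i) *
          coeff (2 * i) (exp ℚ ^ p.1 * phi ^ p.2)) := fun p hp => by
    rw [coeff_C_mul, coeff_saddleIntegral, weightedPart,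
      ← HasAntidiagonal.mem_antidiagonal.1 hp, pow_add]
    ring
  rw [Finset.sum_congr rfl h, ← Finset.mul_sum]
  congr 1
  ext k
  rw [map_sum, closedFormGF, coeff_mk, coeff_mk, closedForm, map_sum]
  have h2 : ∀ l ∈ range (k + 1), coeff N (oddDoubleFactorial (k - l) •
      coeffX (2 * (k - l)) (integrand P l (k - l))) = ∑ p ∈ antidiagonal N,
        coeff p.1 (P l) * (oddDoubleFactorial (k - l) * coeff p.2 (invSqrtPow (k - l)) *
          coeff (2 * (k - l)) (exp ℚ ^ p.1 * phi ^ p.2)) := fun l _ => by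
    rw [coeff_smul, coeff_coeffX, integrand, coeff_mul, map_sum, smul_eq_mul, Finset.mul_sum]
    refine Finset.sum_congr rfl fun p _ => ?_
    rw [coeff_rescale, coeff_rescale, coeff_inZ, coeff_inZ, mul_mul_mul_comm, ← map_mul,
      coeff_mul_C]
    ring
  rw [Finset.sum_congr rfl h2, Finset.sum_comm]
  refine Finset.sum_congr rfl fun p _ => ?_
  rw [coeff_mul, Finset.Nat.sum_antidiagonal_eq_sum_range_succ (fun l i =>
    coeff l (PowerSeries.mk fun l => coeff p.1 (P l)) * coeff i (PowerSeries.mk fun i =>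
        oddDoubleFactorial i * coeff p.2 (invSqrtPow i) *
          coeff (2 * i) (exp ℚ ^ p.1 * phi ^ p.2)))]
  simp only [coeff_mk]

end ClosedForm

/-! ### The tree series -/

/-- The solution of `T = z e ^ T`. -/
def treeSeries : ℚ⟦X⟧ :=
  substInvOfIsUnit (X * rescale (-1 : ℚ) (exp ℚ)) (by rw [show 1 = 0 + 1 from rfl, coeff_succ_X_mul]; simp)

theorem constantCoeff_treeSeries : constantCoeff treeSeries = 0 :=
  constantCoeff_substInvOfIsUnit _ _

theorem treeSeries_spec :
    treeSeries * substSelf treeSeries (rescale (-1 : ℚ) (exp ℚ)) = X := by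
  have h : substSelf treeSeries (X * rescale (-1 : ℚ) (exp ℚ)) = X :=
    subst_substInvOfIsUnit_right _ (by simp) _
  rwa [substSelf_mul constantCoeff_treeSeries, substSelf_X constantCoeff_treeSeries] at h

theorem X_mul_derivative_treeSeries :
    X * (d⁄dX ℚ treeSeries * (1 - treeSeries)) = treeSeries := by
  have h := congrArg (d⁄dX ℚ) treeSeries_spec
  rw [derivative_mul, derivative_substSelf constantCoeff_treeSeries, derivative_rescale_exp,
    substSelf_mul constantCoeff_treeSeries, substSelf_C, derivative_X] at h
  calc X * (d⁄dX ℚ treeSeries * (1 - treeSeries))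
      = treeSeries * (d⁄dX ℚ treeSeries * substSelf treeSeries (rescale (-1 : ℚ) (exp ℚ)) +
        treeSeries * (C (-1) * substSelf treeSeries (rescale (-1 : ℚ) (exp ℚ)) *
          d⁄dX ℚ treeSeries)) := by
        nth_rewrite 1 [← treeSeries_spec]
        rw [map_neg, map_one]
        ring
    _ = treeSeries := by rw [h, mul_one]

/-- The series of unrooted trees. -/
def unrootedSeries : ℚ⟦X⟧ := treeSeries - C (1 / 2) * treeSeries ^ 2

/-- Pointing at a vertex: z U' = z T'(1 - T) = T. -/
theorem coeff_unrootedSeries (n : ℕ) :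
    (n : ℚ) * coeff n unrootedSeries = coeff n treeSeries := by
  have h : X * d⁄dX ℚ unrootedSeries = treeSeries := by
    rw [unrootedSeries, map_sub, derivative_C_mul, derivative_pow]
    nth_rewrite 4 [← X_mul_derivative_treeSeries]
    have : (C (1 / 2 : ℚ) : ℚ⟦X⟧) * 2 = 1 := by
      rw [show (2 : ℚ⟦X⟧) = C 2 from (map_ofNat C 2).symm, ← map_mul]
      norm_num
    linear_combination (-X * treeSeries * d⁄dX ℚ treeSeries) * this
  cases n with
  | zero =>
    rw [coeff_zero_eq_constantCoeff_apply treeSeries, constantCoeff_treeSeries]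
    simp
  | succ n =>
    rw [← h, coeff_succ_X_mul, coeff_derivative]
    push_cast
    ring

/-- `T(z y) / y`. -/
def scaledTree : ℚ⟦X⟧⟦X⟧ := PowerSeries.mk fun n => C (coeff n treeSeries) * X ^ (n - 1)

theorem C_X_mul_scaledTree : C (X : ℚ⟦X⟧) * scaledTree = rescale X (inZ treeSeries) := by
  ext1 n
  rw [coeff_C_mul, coeff_rescale, coeff_inZ, scaledTree, coeff_mk]
  cases n with
  -- The truncated exponent 0 - 1 is harmless because T has no constant term.
  | zero => rw [coeff_zero_eq_constantCoeff_apply, constantCoeff_treeSeries]; simp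
  | succ n => rw [Nat.add_sub_cancel, pow_succ]; ring

theorem constantCoeff_scaledTree : constantCoeff scaledTree = 0 := by
  rw [← coeff_zero_eq_constantCoeff_apply, scaledTree, coeff_mk,
    coeff_zero_eq_constantCoeff_apply, constantCoeff_treeSeries]
  simp

theorem C_X_ne_zero : (C (X : ℚ⟦X⟧) : ℚ⟦X⟧⟦X⟧) ≠ 0 := by
  intro h
  have := congrArg (coeff 1) (C_injective (h.trans (map_zero _).symm))
  simp at this

theorem substSelf_scaledTree_inZ (f : ℚ⟦X⟧) :
    substSelf scaledTree (rescale X (inZ f)) = rescale X (inZ (substSelf treeSeries f)) := by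
  rw [substSelf_rescale constantCoeff_scaledTree, C_X_mul_scaledTree,
    rescale_substSelf (constantCoeff_inZ constantCoeff_treeSeries),
    substSelf_inZ constantCoeff_treeSeries]

theorem rescale_neg_X_exp :
    rescale (-X : ℚ⟦X⟧) (exp ℚ⟦X⟧) = rescale X (inZ (rescale (-1 : ℚ) (exp ℚ))) := by
  ext1 n
  rw [coeff_rescale_exp, coeff_rescale, coeff_inZ, coeff_rescale_exp, neg_pow, smul_eq_C_mul,
    smul_eq_mul, map_mul, map_pow]
  simp
  ring

/-- The relation T e^{-T} = z, taken at zy and divided by y: τ = T(zy)/y inverts τ ↦ τ e^{-yτ}. -/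
theorem substSelf_scaledTree_spec :
    substSelf scaledTree (X * rescale (-X : ℚ⟦X⟧) (exp ℚ⟦X⟧)) = X := by
  rw [substSelf_mul constantCoeff_scaledTree, substSelf_X constantCoeff_scaledTree,
    rescale_neg_X_exp, substSelf_scaledTree_inZ]
  -- Division by y is a cancellation in a domain.
  refine mul_left_cancel₀ C_X_ne_zero ?_
  rw [← mul_assoc, C_X_mul_scaledTree, ← map_mul, ← inZ_mul, treeSeries_spec]
  rw [inZ, map_X, rescale_X]

theorem substSelf_scaledTree_rescale (M : ℚ⟦X⟧⟦X⟧) :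
    substSelf scaledTree (rescale X M) = rescale X (substSelf (inZ treeSeries) M) := by
  rw [substSelf_rescale constantCoeff_scaledTree, C_X_mul_scaledTree,
    rescale_substSelf (constantCoeff_inZ constantCoeff_treeSeries)]

/-- `U(z y) / y` for the series `U` of unrooted trees. -/
def scaledUnrooted : ℚ⟦X⟧⟦X⟧ := scaledTree - C (C (1 / 2 : ℚ) * X) * scaledTree ^ 2

theorem constantCoeff_scaledUnrooted : constantCoeff scaledUnrooted = 0 := by
  rw [scaledUnrooted, map_sub, map_mul, map_pow, constantCoeff_scaledTree]
  simp

theorem C_X_mul_scaledUnrooted :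
    C (X : ℚ⟦X⟧) * scaledUnrooted = rescale X (inZ unrootedSeries) := by
  rw [unrootedSeries, inZ_sub, inZ_mul, inZ_pow, map_sub, map_mul, map_pow, ← C_X_mul_scaledTree,
    scaledUnrooted, map_mul]
  rw [show rescale X (inZ (C (1 / 2 : ℚ))) = (C (C (1 / 2 : ℚ)) : ℚ⟦X⟧⟦X⟧) by
    rw [inZ, map_C]
    ext1 n
    rw [coeff_rescale, coeff_C]
    cases n <;> simp]
  ring

theorem coeff_scaledUnrooted (n : ℕ) : coeff (n + 1) scaledUnrooted =
    C (coeff (n + 1) unrootedSeries) * X ^ n := by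
  have h := congrArg (coeff (n + 1)) C_X_mul_scaledUnrooted
  rw [coeff_C_mul, coeff_rescale, coeff_inZ, pow_succ', mul_assoc] at h
  rw [mul_left_cancel₀ X_ne_zero h, mul_comm]

/-- At τ = T(zy)/y the exponent τ - τ²y/2 becomes U(zy)/y. The prefactor is thus the exponential of
a series of pure excess -1, recorded by its differential equation. -/
theorem derivative_substSelf_saddleExp :
    d⁄dX ℚ⟦X⟧ (substSelf scaledTree saddleExp) =
      d⁄dX ℚ⟦X⟧ scaledUnrooted * substSelf scaledTree saddleExp := by
  rw [derivative_substSelf constantCoeff_scaledTree, derivative_saddleExp,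
    substSelf_mul constantCoeff_scaledTree, substSelf_sub constantCoeff_scaledTree,
    substSelf_one, substSelf_mul constantCoeff_scaledTree, substSelf_C,
    substSelf_X constantCoeff_scaledTree, scaledUnrooted, map_sub, derivative_C_mul,
    derivative_pow]
  have : (C (C (1 / 2 : ℚ) * X : ℚ⟦X⟧) : ℚ⟦X⟧⟦X⟧) * 2 = C X := by
    rw [show (2 : ℚ⟦X⟧⟦X⟧) = C (C 2) from (map_ofNat (C.comp C) 2).symm, ← map_mul,
      mul_right_comm, ← map_mul]
    norm_num
  push_cast
  linear_combination (scaledTree * d⁄dX ℚ⟦X⟧ scaledTree * substSelf scaledTree saddleExp) * this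

/-! ### Extraction of the components of positive excess -/

/-- The part of a bivariate series where the exponent of `w` exceeds that of `z`. -/
def positivePart (K : ℚ⟦X⟧⟦X⟧) : ℚ⟦X⟧⟦X⟧ :=
  PowerSeries.mk fun n => PowerSeries.mk fun m => if n < m then coeff m (coeff n K) else 0

/-- Provides a logarithm of a series H with constant term 1, as the antiderivative of H'/H. -/
theorem exists_antiderivative (f : ℚ⟦X⟧⟦X⟧) :
    ∃ D : ℚ⟦X⟧⟦X⟧, constantCoeff D = 0 ∧ d⁄dX ℚ⟦X⟧ D = f := by
  refine ⟨X * PowerSeries.mk fun n => C (1 / ((n : ℚ) + 1)) * coeff n f, by simp, ?_⟩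
  ext1 n
  have hn : (n : ℚ) + 1 ≠ 0 := by positivity
  rw [coeff_derivative, coeff_succ_X_mul, coeff_mk,
    show (n : ℚ⟦X⟧) + 1 = C ((n : ℚ) + 1) by simp, mul_right_comm, ← map_mul,
    one_div_mul_cancel hn, map_one, one_mul]

/-- The bivariate series of all objects, in terms of the parts `P_l`. -/
def totalGF (P : ℕ → ℚ⟦X⟧) : ℚ⟦X⟧⟦X⟧ :=
  PowerSeries.mk fun n =>
    (∑ q ∈ antidiagonal n, weightedPart P q.1 * C (1 / (q.2 ! : ℚ))) * gaussExp n

/-- The saddle point identity evaluated at τ = T(zy)/y, where τ e^{-yτ} = z and the right side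
becomes the total series. -/
theorem totalGF_eq (P : ℕ → ℚ⟦X⟧) : totalGF P =
    substSelf scaledTree saddleExp * rescale X (substSelf (inZ treeSeries) (closedFormGF P)) := by
  have h := congrArg (substSelf scaledTree) (saddleExp_mul_shiftSum (weightedPart P))
  rw [substSelf_mul constantCoeff_scaledTree, shiftSum_saddleIntegral,
    substSelf_scaledTree_rescale] at h
  rw [h]
  change _ = substSelf scaledTree (substSelf _ (totalGF P))
  rw [substSelf_substSelf (by simp) constantCoeff_scaledTree, substSelf_scaledTree_spec,
    X_substSelf]

variable {P : ℕ → ℚ⟦X⟧} {K : ℚ⟦X⟧⟦X⟧}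

/-- The total series is a product of exp(U(zy)/y) and a series of nonnegative excess. Logarithmic
derivatives add, so K splits into excess -1 and excess at least 0. -/
theorem exists_log (h0 : constantCoeff (totalGF P) = 1) (hK0 : constantCoeff K = 0)
    (hK : d⁄dX ℚ⟦X⟧ (totalGF P) = d⁄dX ℚ⟦X⟧ K * totalGF P) :
    constantCoeff (substSelf (inZ treeSeries) (closedFormGF P)) = 1 ∧
    ∃ D : ℚ⟦X⟧⟦X⟧, K = scaledUnrooted + rescale X D ∧ constantCoeff D = 0 ∧
      d⁄dX ℚ⟦X⟧ (substSelf (inZ treeSeries) (closedFormGF P)) =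
        d⁄dX ℚ⟦X⟧ D * substSelf (inZ treeSeries) (closedFormGF P) := by
  have hF := totalGF_eq P
  set H := substSelf (inZ treeSeries) (closedFormGF P)
  set E := substSelf scaledTree saddleExp with hE
  have hE0 : constantCoeff E = 1 := by
    rw [hE, constantCoeff_substSelf constantCoeff_scaledTree, constantCoeff_saddleExp]
  have hE1 : E ≠ 0 := fun h => by simp [h] at hE0
  have hH0 : constantCoeff H = 1 := by
    rw [hF, map_mul, hE0, constantCoeff_rescale, one_mul] at h0
    exact h0
  refine ⟨hH0, ?_⟩
  obtain ⟨u, hu⟩ : IsUnit H := by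
    rw [isUnit_iff_constantCoeff, hH0]
    exact isUnit_one
  obtain ⟨D, hD0, hD⟩ := exists_antiderivative (d⁄dX ℚ⟦X⟧ H * ↑u⁻¹)
  have hDH : d⁄dX ℚ⟦X⟧ H = d⁄dX ℚ⟦X⟧ D * H := by
    rw [hD, mul_assoc, ← hu, Units.inv_mul, mul_one]
  refine ⟨D, ?_, hD0, hDH⟩
  have hH1 : rescale X H ≠ 0 := fun h => by
    have := constantCoeff_rescale X H
    rw [h, hH0] at this
    simp at this
  have : IsAddTorsionFree ℚ⟦X⟧ := IsAddTorsionFree.of_module_rat _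
  refine derivative.ext ?_ ?_
  · rw [hF, derivative_mul, derivative_rescale X H, hDH, map_mul, derivative_substSelf_saddleExp,
      ← hE] at hK
    rw [map_add, derivative_rescale]
    refine mul_right_cancel₀ (mul_ne_zero hE1 hH1) ?_
    rw [← hK]
    ring
  · rw [hK0, map_add, constantCoeff_scaledUnrooted, constantCoeff_rescale, hD0, zero_add]

/-- The part of excess `-1` of the logarithm is the series of unrooted trees. -/
theorem coeff_log_tree (h0 : constantCoeff (totalGF P) = 1) (hK0 : constantCoeff K = 0)
    (hK : d⁄dX ℚ⟦X⟧ (totalGF P) = d⁄dX ℚ⟦X⟧ K * totalGF P) (n : ℕ) :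
    coeff n (coeff (n + 1) K) = coeff (n + 1) unrootedSeries := by
  obtain ⟨-, D, rfl, -, -⟩ := exists_log h0 hK0 hK
  -- The term `rescale X D` has no monomial with fewer powers of w than of z.
  rw [map_add, coeff_scaledUnrooted, coeff_rescale, map_add, coeff_C_mul, coeff_X_pow_self,
    mul_one, coeff_X_pow_mul', if_neg (by omega), add_zero]

/-- Components of excess -1 contribute the prefactor and those of excess 0 contribute e^V. Removing
both from the exponential of K leaves H e^{-V}, and V does not involve y, so it passes through the
extraction of excess k. -/
theorem excessPart_positive (h0 : constantCoeff (totalGF P) = 1) (hK0 : constantCoeff K = 0)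
    (hK : d⁄dX ℚ⟦X⟧ (totalGF P) = d⁄dX ℚ⟦X⟧ K * totalGF P)
    {A : ℚ⟦X⟧⟦X⟧} (hA0 : constantCoeff A = 1)
    (hA : d⁄dX ℚ⟦X⟧ A = d⁄dX ℚ⟦X⟧ (positivePart K) * A) (k : ℕ) :
    excessPart A k = substSelf treeSeries (closedForm P k) * expOf (-excessPart K 0) := by
  obtain ⟨hH0, D, hKD, hD0, hD⟩ := exists_log h0 hK0 hK
  set H := substSelf (inZ treeSeries) (closedFormGF P) with hH
  set V := excessPart K 0 with hV
  have hcoeff : ∀ n m, coeff (n + m) (coeff n K) = coeff m (coeff n D) ∨ n = 0 := by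
    intro n m
    cases n with
    | zero => exact Or.inr rfl
    | succ n =>
      left
      rw [hKD, map_add, coeff_scaledUnrooted, coeff_rescale, map_add, coeff_C_mul, coeff_X_pow,
        if_neg (by omega), mul_zero, zero_add, add_comm (n + 1) m, coeff_X_pow_mul]
  have hV0 : constantCoeff V = 0 := by
    rw [← coeff_zero_eq_constantCoeff_apply, hV, coeff_excessPart,
      coeff_zero_eq_constantCoeff_apply K, hK0, map_zero]
  -- Excess -1 belongs to U alone, excess 0 is V, and every positive excess comes from D.
  have hpos : positivePart K = rescale X (D - inZ V) := by
    ext n m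
    rw [positivePart, coeff_mk, coeff_mk, coeff_rescale, map_sub, coeff_inZ]
    rcases Nat.eq_zero_or_pos n with rfl | hn
    · rw [coeff_zero_eq_constantCoeff_apply, hK0, coeff_zero_eq_constantCoeff_apply, hD0,
        coeff_zero_eq_constantCoeff_apply, hV0]
      simp
    · rcases lt_trichotomy n m with h | rfl | h
      · obtain ⟨j, rfl⟩ := Nat.exists_eq_add_of_lt h
        rw [if_pos h, add_assoc, (hcoeff n (j + 1)).resolve_right (by omega), add_comm n,
          coeff_X_pow_mul, map_sub, coeff_C, if_neg (by omega), sub_zero]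
      · have := (hcoeff n 0).resolve_right (by omega)
        rw [if_neg (lt_irrefl _), coeff_X_pow_mul', if_pos le_rfl, Nat.sub_self, map_sub,
          coeff_zero_C, hV, coeff_excessPart, this, sub_self]
      · rw [if_neg (by omega), coeff_X_pow_mul', if_neg (by omega)]
  have hV1 : constantCoeff (-V) = 0 := by rw [map_neg, hV0, neg_zero]
  have hexp : expOf (-V) = expS (-V) := rfl
  set G := H * inZ (expOf (-V)) with hG
  have hGd : d⁄dX ℚ⟦X⟧ G = d⁄dX ℚ⟦X⟧ (D - inZ V) * G := by
    rw [hG, derivative_mul, derivative_inZ, hexp, derivative_expS hV1, hD, map_neg, inZ_mul,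
      inZ_neg, ← derivative_inZ, map_sub]
    ring
  have hAG : A = rescale X G := by
    refine eq_of_derivative_eq_mul hA ?_ ?_
    · rw [derivative_rescale, hGd, hpos, derivative_rescale, map_mul, mul_assoc]
    · rw [hA0, constantCoeff_rescale, hG, map_mul, hH0, ← coeff_zero_eq_constantCoeff_apply,
        coeff_inZ, coeff_zero_eq_constantCoeff_apply, hexp, constantCoeff_expS hV1]
      simp
  rw [hAG, excessPart_rescale, hG, coeffX_mul_inZ, hH,
    coeffX_substSelf_inZ constantCoeff_treeSeries, coeffX_closedFormGF]

/-- The closed formula in the form of the statement. -/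
theorem substSelf_closedForm_mul {T : ℚ⟦X⟧} (hT : constantCoeff T = 0) (P : ℕ → ℚ⟦X⟧) (f : ℚ⟦X⟧)
    (k : ℕ) :
    substSelf T (closedForm P k) * f = ∑ l ∈ range (k + 1), oddDoubleFactorial (k - l) •
      coeffX (2 * (k - l)) (comp (P l) (inZ T * inX (exp ℚ)) * inZ f *
        invOneSubRPow (inZ T * inX phi) (((k - l : ℕ) : ℚ) + 1 / 2)) := by
  have h : substSelf T (closedForm P k) = ∑ l ∈ range (k + 1), oddDoubleFactorial (k - l) •
      substSelf T (coeffX (2 * (k - l)) (integrand P l (k - l))) := by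
    have hT' := HasSubst.of_constantCoeff_zero' hT
    simp only [substSelf, closedForm, ← coe_substAlgHom hT', map_sum, map_smul]
  rw [h, Finset.sum_mul]
  refine Finset.sum_congr rfl fun l _ => ?_
  rw [smul_mul_assoc, ← coeffX_substSelf_inZ hT, ← coeffX_mul_inZ, comp_inZ_mul_inX hT,
    invOneSubRPow_inZ_mul_inX hT, integrand, substSelf_mul (constantCoeff_inZ hT), mul_right_comm]

end PowerSeriesIdentities

/-! ### Enumeration: weighted multiplicity functions, graphs, multigraphs and patchworks. -/

section Enumeration

open Finset Relation

/-! ### Edge multiplicities and the exponential formula -/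

section Multiplicity

variable {V : Type*}

/-- `v` and `w` are linked by a path of edges of nonzero multiplicity. -/
def Joined (μ : Sym2 V → ℕ) : V → V → Prop := ReflTransGen fun v w => μ s(v, w) ≠ 0

theorem Joined.symm {μ : Sym2 V → ℕ} {v w : V} (h : Joined μ v w) : Joined μ w v := by
  induction h with
  | refl => exact ReflTransGen.refl
  | tail _ hbc ih => exact ReflTransGen.head (by rwa [Sym2.eq_swap]) ih

theorem Joined.of_closed {μ ν : Sym2 V → ℕ} {B : Finset V}
    (h : ∀ v ∈ B, ∀ w, μ s(v, w) ≠ 0 → w ∈ B ∧ ν s(v, w) ≠ 0) {v w : V} (hv : v ∈ B)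
    (hvw : Joined μ v w) : w ∈ B ∧ Joined ν v w := by
  induction hvw with
  | refl => exact ⟨hv, ReflTransGen.refl⟩
  | tail _ hbc ih => exact ⟨(h _ ih.1 _ hbc).1, ih.2.tail (h _ ih.1 _ hbc).2⟩

theorem Joined.mono {μ ν : Sym2 V → ℕ} (h : ∀ e, μ e ≠ 0 → ν e ≠ 0) {v w : V}
    (hvw : Joined μ v w) : Joined ν v w := by
  induction hvw with
  | refl => exact ReflTransGen.refl
  | tail _ hbc ih => exact ih.tail (h _ hbc)

open Classical in
/-- The component of `v` in `S`. -/
def cell (μ : Sym2 V → ℕ) (S : Finset V) (v : V) : Finset V := S.filter (Joined μ v)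

theorem mem_cell {μ : Sym2 V → ℕ} {S : Finset V} {v w : V} :
    w ∈ cell μ S v ↔ w ∈ S ∧ Joined μ v w := by
  classical
  exact mem_filter

/-- The number of edges inside `B`, with multiplicity. -/
def edgeCount (μ : Sym2 V → ℕ) (B : Finset V) : ℕ := ∑ e ∈ B.sym2, μ e

/-- `S` is nonempty and connected. -/
def IsConn (S : Finset V) (μ : Sym2 V → ℕ) : Prop :=
  S.Nonempty ∧ ∀ v ∈ S, ∀ w ∈ S, Joined μ v w

/-- The numbers of vertices and edges of all components of `S` satisfy `Q`. -/
def CellsIn (Q : ℕ → ℕ → Prop) (S : Finset V) (μ : Sym2 V → ℕ) : Prop :=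
  ∀ v ∈ S, Q (cell μ S v).card (edgeCount μ (cell μ S v))

/-- The weight of a multiple loop and of a multiple edge, as functions of the multiplicity. -/
structure EdgeWeight where
  diag : ℕ → ℚ
  off : ℕ → ℚ
  diag_zero : diag 0 = 1
  off_zero : off 0 = 1

open Classical in
/-- The weight of `k` copies of `e`. -/
def EdgeWeight.ofMult (ω : EdgeWeight) (e : Sym2 V) (k : ℕ) : ℚ :=
  if e.IsDiag then ω.diag k else ω.off k

theorem EdgeWeight.ofMult_zero (ω : EdgeWeight) (e : Sym2 V) : ω.ofMult e 0 = 1 := by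
  rw [EdgeWeight.ofMult]
  split_ifs
  exacts [ω.diag_zero, ω.off_zero]

/-- The weight of a multiplicity function. -/
def weight (ω : EdgeWeight) (S : Finset V) (μ : Sym2 V → ℕ) : ℚ :=
  ∏ e ∈ S.sym2, ω.ofMult e (μ e)

open Classical in
/-- The series in `w` of the multigraphs on `S` all of whose components satisfy `Q`. -/
def total [DecidableEq V] (ω : EdgeWeight) (Q : ℕ → ℕ → Prop) (S : Finset V) : ℚ⟦X⟧ :=
  PowerSeries.mk fun m => ∑ μ ∈ (piAntidiag S.sym2 m).filter (CellsIn Q S), weight ω S μ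

open Classical in
/-- The series in `w` of the connected multigraphs on `S` satisfying `Q`. -/
def connected [DecidableEq V] (ω : EdgeWeight) (Q : ℕ → ℕ → Prop) (S : Finset V) : ℚ⟦X⟧ :=
  PowerSeries.mk fun m =>
    ∑ μ ∈ (piAntidiag S.sym2 m).filter (fun μ => IsConn S μ ∧ Q S.card m), weight ω S μ

open Classical in
/-- The edges inside `B`. -/
def inside (μ : Sym2 V → ℕ) (B : Finset V) : Sym2 V → ℕ := fun e => if e ∈ B.sym2 then μ e else 0

theorem inside_of_mem {μ : Sym2 V → ℕ} {B : Finset V} {e : Sym2 V} (h : e ∈ B.sym2) :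
    inside μ B e = μ e := if_pos h

theorem inside_of_notMem {μ : Sym2 V → ℕ} {B : Finset V} {e : Sym2 V} (h : e ∉ B.sym2) :
    inside μ B e = 0 := if_neg h

theorem edgeCount_congr {μ ν : Sym2 V → ℕ} {B : Finset V} (h : ∀ e ∈ B.sym2, μ e = ν e) :
    edgeCount μ B = edgeCount ν B := Finset.sum_congr rfl h

theorem notMem_sym2_of_disjoint {B D : Finset V} (hBD : Disjoint B D) {e : Sym2 V}
    (he : e ∈ B.sym2) : e ∉ D.sym2 := by
  induction e with
  | _ a b =>
    intro h
    exact Finset.disjoint_left.1 hBD (mk_mem_sym2_iff.1 he).1 (mk_mem_sym2_iff.1 h).1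

theorem IsConn.cell_eq {B : Finset V} {μ : Sym2 V → ℕ} (h : IsConn B μ) {v : V} (hv : v ∈ B) :
    cell μ B v = B := by
  ext w
  rw [mem_cell]
  exact ⟨fun h => h.1, fun hw => ⟨hw, h.2 v hv w hw⟩⟩

theorem IsConn.cellsIn_iff {B : Finset V} {μ : Sym2 V → ℕ} (h : IsConn B μ)
    (Q : ℕ → ℕ → Prop) : CellsIn Q B μ ↔ Q B.card (edgeCount μ B) := by
  constructor
  · intro hc
    obtain ⟨v, hv⟩ := h.1
    have := hc v hv
    rwa [h.cell_eq hv] at this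
  · intro hc v hv
    rwa [h.cell_eq hv]

/-! ### Superposition of edges on two disjoint vertex sets. -/

section Split

variable {B D : Finset V} {μ ν : Sym2 V → ℕ}

theorem add_eq_left (hBD : Disjoint B D) (hν : ∀ e, ν e ≠ 0 → e ∈ D.sym2) {e : Sym2 V}
    (he : e ∈ B.sym2) : (μ + ν) e = μ e := by
  have : ν e = 0 := by
    by_contra h
    exact notMem_sym2_of_disjoint hBD he (hν e h)
  rw [Pi.add_apply, this, add_zero]

theorem joined_add_left (hBD : Disjoint B D) (hμ : ∀ e, μ e ≠ 0 → e ∈ B.sym2)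
    (hν : ∀ e, ν e ≠ 0 → e ∈ D.sym2) {v w : V} (hv : v ∈ B) :
    Joined (μ + ν) v w ↔ w ∈ B ∧ Joined μ v w := by
  constructor
  · refine Joined.of_closed ?_ hv
    intro a ha b hab
    have h1 : ν s(a, b) = 0 := by
      by_contra h
      exact Finset.disjoint_left.1 hBD ha (mk_mem_sym2_iff.1 (hν _ h)).1
    rw [Pi.add_apply, h1, add_zero] at hab
    exact ⟨(mk_mem_sym2_iff.1 (hμ _ hab)).2, hab⟩
  · rintro ⟨-, h⟩
    refine h.mono fun e he => ?_
    rw [Pi.add_apply]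
    omega

theorem edgeCount_cell_add_left (hBD : Disjoint B D)
    (hν : ∀ e, ν e ≠ 0 → e ∈ D.sym2) (v : V) :
    edgeCount (μ + ν) (cell μ B v) = edgeCount μ (cell μ B v) := by
  refine edgeCount_congr fun e he => add_eq_left hBD hν ?_
  exact sym2_mono (fun w hw => (mem_cell.1 hw).1) he

variable [DecidableEq V]

theorem cell_add_left (hBD : Disjoint B D) (hμ : ∀ e, μ e ≠ 0 → e ∈ B.sym2)
    (hν : ∀ e, ν e ≠ 0 → e ∈ D.sym2) {v : V} (hv : v ∈ B) :
    cell (μ + ν) (B ∪ D) v = cell μ B v := by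
  ext w
  rw [mem_cell, mem_cell, joined_add_left hBD hμ hν hv, mem_union]
  tauto

theorem cellsIn_add (hBD : Disjoint B D) (hμ : ∀ e, μ e ≠ 0 → e ∈ B.sym2)
    (hν : ∀ e, ν e ≠ 0 → e ∈ D.sym2) (Q : ℕ → ℕ → Prop) :
    CellsIn Q (B ∪ D) (μ + ν) ↔ CellsIn Q B μ ∧ CellsIn Q D ν := by
  have hl : ∀ v ∈ B, (Q (cell (μ + ν) (B ∪ D) v).card (edgeCount (μ + ν)
      (cell (μ + ν) (B ∪ D) v)) ↔ Q (cell μ B v).card (edgeCount μ (cell μ B v))) :=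
    fun v hv => by rw [cell_add_left hBD hμ hν hv, edgeCount_cell_add_left hBD hν]
  have hr : ∀ v ∈ D, (Q (cell (μ + ν) (B ∪ D) v).card (edgeCount (μ + ν)
      (cell (μ + ν) (B ∪ D) v)) ↔ Q (cell ν D v).card (edgeCount ν (cell ν D v))) :=
    fun v hv => by
      rw [union_comm, add_comm, cell_add_left hBD.symm hν hμ hv,
        edgeCount_cell_add_left hBD.symm hμ]
  constructor
  · intro h
    exact ⟨fun v hv => (hl v hv).1 (h v (mem_union_left _ hv)),
      fun v hv => (hr v hv).1 (h v (mem_union_right _ hv))⟩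
  · rintro ⟨h1, h2⟩ v hv
    rcases mem_union.1 hv with hv | hv
    · exact (hl v hv).2 (h1 v hv)
    · exact (hr v hv).2 (h2 v hv)

theorem prod_sym2_union (hBD : Disjoint B D) {M : Type*} [CommMonoid M] (f : Sym2 V → M)
    (hf : ∀ e, e ∉ B.sym2 → e ∉ D.sym2 → f e = 1) :
    ∏ e ∈ (B ∪ D).sym2, f e = (∏ e ∈ B.sym2, f e) * ∏ e ∈ D.sym2, f e := by
  rw [← Finset.prod_union (Finset.disjoint_left.2 fun e => notMem_sym2_of_disjoint hBD)]
  refine (Finset.prod_subset (union_subset (sym2_mono subset_union_left)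
    (sym2_mono subset_union_right)) fun e _ he => ?_).symm
  rw [mem_union, not_or] at he
  exact hf e he.1 he.2

theorem weight_add (ω : EdgeWeight) (hBD : Disjoint B D) (hμ : ∀ e, μ e ≠ 0 → e ∈ B.sym2)
    (hν : ∀ e, ν e ≠ 0 → e ∈ D.sym2) :
    weight ω (B ∪ D) (μ + ν) = weight ω B μ * weight ω D ν := by
  rw [weight, prod_sym2_union hBD]
  · congr 1
    · exact Finset.prod_congr rfl fun e he => by rw [add_eq_left hBD hν he]
    · refine Finset.prod_congr rfl fun e he => ?_
      rw [add_comm, add_eq_left hBD.symm hμ he]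
  · intro e h1 h2
    have h1' : μ e = 0 := by_contra fun h => h1 (hμ e h)
    have h2' : ν e = 0 := by_contra fun h => h2 (hν e h)
    rw [Pi.add_apply, h1', h2', add_zero, ω.ofMult_zero]

theorem edgeCount_add (hBD : Disjoint B D) (hμ : ∀ e, μ e ≠ 0 → e ∈ B.sym2)
    (hν : ∀ e, ν e ≠ 0 → e ∈ D.sym2) :
    edgeCount (μ + ν) (B ∪ D) = edgeCount μ B + edgeCount ν D := by
  -- The additive splitting is the multiplicative one read in `Multiplicative ℕ`.
  have h := prod_sym2_union hBD (fun e => Multiplicative.ofAdd ((μ + ν) e)) (fun e h1 h2 => by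
    have h1' : μ e = 0 := by_contra fun h => h1 (hμ e h)
    have h2' : ν e = 0 := by_contra fun h => h2 (hν e h)
    rw [Pi.add_apply, h1', h2']
    rfl)
  have h' : edgeCount (μ + ν) (B ∪ D) = edgeCount (μ + ν) B + edgeCount (μ + ν) D := h
  rw [h', edgeCount_congr (fun e he => add_eq_left hBD hν he)]
  congr 1
  rw [add_comm]
  exact edgeCount_congr (fun e he => add_eq_left hBD.symm hμ he)

end Split

variable [DecidableEq V]

theorem mem_piAntidiag_sym2 {S : Finset V} {m : ℕ} {μ : Sym2 V → ℕ} :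
    μ ∈ piAntidiag S.sym2 m ↔ edgeCount μ S = m ∧ ∀ e, μ e ≠ 0 → e ∈ S.sym2 := mem_piAntidiag

theorem inside_support (μ : Sym2 V → ℕ) (B : Finset V) :
    ∀ e, inside μ B e ≠ 0 → e ∈ B.sym2 := fun e he => by
  by_contra h
  exact he (inside_of_notMem h)

/-- No edge links a component to its complement. -/
theorem inside_add_inside {S : Finset V} {μ : Sym2 V → ℕ} (hμ : ∀ e, μ e ≠ 0 → e ∈ S.sym2)
    (v : V) : inside μ (cell μ S v) + inside μ (S \ cell μ S v) = μ := by
  have hdis : Disjoint (cell μ S v) (S \ cell μ S v) := disjoint_sdiff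
  funext e
  rw [Pi.add_apply]
  by_cases h1 : e ∈ (cell μ S v).sym2
  · rw [inside_of_mem h1, inside_of_notMem (notMem_sym2_of_disjoint hdis h1), add_zero]
  · by_cases h2 : e ∈ (S \ cell μ S v).sym2
    · rw [inside_of_mem h2, inside_of_notMem h1, zero_add]
    · rw [inside_of_notMem h1, inside_of_notMem h2]
      by_contra h
      have he := hμ e (fun h' => h (by rw [h']))
      have h0 : μ e ≠ 0 := fun h' => h (by rw [h'])
      clear h
      induction e with
      | _ a b =>
        rw [mk_mem_sym2_iff] at h1 h2 he
        have key : ∀ x y, μ s(x, y) ≠ 0 → x ∈ S → y ∈ S → x ∈ cell μ S v → y ∈ cell μ S v :=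
          fun x y hxy _ hy hx => mem_cell.2 ⟨hy, (mem_cell.1 hx).2.tail hxy⟩
        have k1 := key a b h0 he.1 he.2
        have k2 := key b a (by rwa [Sym2.eq_swap]) he.2 he.1
        simp only [mem_sdiff] at h2
        tauto

theorem isConn_inside_cell {S : Finset V} {μ : Sym2 V → ℕ} (hμ : ∀ e, μ e ≠ 0 → e ∈ S.sym2)
    {v : V} (hv : v ∈ S) : IsConn (cell μ S v) (inside μ (cell μ S v)) := by
  have hvc : v ∈ cell μ S v := mem_cell.2 ⟨hv, ReflTransGen.refl⟩
  have key : ∀ w ∈ cell μ S v, Joined (inside μ (cell μ S v)) v w := fun w hw => by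
    have h := (mem_cell.1 hw).2
    rw [← inside_add_inside hμ v] at h
    exact ((joined_add_left disjoint_sdiff (inside_support _ _) (inside_support _ _) hvc).1 h).2
  exact ⟨⟨v, hvc⟩, fun a ha b hb => (key a ha).symm.trans (key b hb)⟩

open Classical in
-- Restriction to B and to its complement is inverse to addition. Edge counts add, weights multiply,
-- and the condition on components splits, with B itself the only component of the first half.
theorem sum_cell_eq (ω : EdgeWeight) (Q : ℕ → ℕ → Prop) {S B : Finset V} {v : V} (hvB : v ∈ B)
    (hBS : B ⊆ S) (m : ℕ) :
    ∑ μ ∈ ((piAntidiag S.sym2 m).filter (CellsIn Q S)).filter (fun μ => cell μ S v = B),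
      weight ω S μ = PowerSeries.coeff m (connected ω Q B * total ω Q (S \ B)) := by
  have hdis : Disjoint B (S \ B) := disjoint_sdiff
  have hun : B ∪ S \ B = S := union_sdiff_of_subset hBS
  rw [PowerSeries.coeff_mul]
  simp only [connected, total, PowerSeries.coeff_mk, Finset.sum_mul_sum, ← Finset.sum_product']
  rw [Finset.sum_sigma']
  refine Finset.sum_bij'
    (fun μ _ => (⟨(edgeCount (inside μ B) B, edgeCount (inside μ (S \ B)) (S \ B)),
      (inside μ B, inside μ (S \ B))⟩ : (_ : ℕ × ℕ) × (Sym2 V → ℕ) × (Sym2 V → ℕ)))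
    (fun s _ => s.2.1 + s.2.2) ?_ ?_ ?_ ?_ ?_
  · intro μ hμ
    simp only [mem_filter, mem_piAntidiag_sym2] at hμ
    obtain ⟨⟨⟨h1, h2⟩, h3⟩, h4⟩ := hμ
    have hadd := inside_add_inside h2 v
    have hconn := isConn_inside_cell h2 (hBS hvB)
    rw [h4] at hadd hconn
    have hsup := inside_support μ B
    have hsup' := inside_support μ (S \ B)
    have hc := (cellsIn_add hdis hsup hsup' Q).1 (by rwa [hadd, hun])
    have he := edgeCount_add hdis hsup hsup'
    rw [hadd, hun, h1] at he
    simp only [mem_sigma, HasAntidiagonal.mem_antidiagonal, mem_product, mem_filter,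
      mem_piAntidiag_sym2]
    exact ⟨he.symm, ⟨⟨trivial, hsup⟩, hconn, (hconn.cellsIn_iff Q).1 hc.1⟩, ⟨trivial, hsup'⟩, hc.2⟩
  · rintro ⟨⟨i, j⟩, ⟨μ, ν⟩⟩ hs
    simp only [mem_sigma, HasAntidiagonal.mem_antidiagonal, mem_product, mem_filter,
      mem_piAntidiag_sym2] at hs ⊢
    obtain ⟨h1, ⟨⟨h2, h3⟩, h4, h5⟩, ⟨h6, h7⟩, h8⟩ := hs
    have he := edgeCount_add hdis h3 h7
    have hc := (cellsIn_add hdis h3 h7 Q).2 ⟨(h4.cellsIn_iff Q).2 (by rwa [h2]), h8⟩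
    have hcell := cell_add_left hdis h3 h7 hvB
    rw [hun] at he hc hcell
    refine ⟨⟨⟨by rw [he, h2, h6, h1], fun e hne => ?_⟩, hc⟩, by rw [hcell, h4.cell_eq hvB]⟩
    rw [Pi.add_apply] at hne
    by_cases hz : μ e = 0
    · exact sym2_mono sdiff_subset (h7 e (by omega))
    · exact sym2_mono hBS (h3 e hz)
  · intro μ hμ
    simp only [mem_filter, mem_piAntidiag_sym2] at hμ
    obtain ⟨⟨⟨h1, h2⟩, h3⟩, h4⟩ := hμ
    have hadd := inside_add_inside h2 v
    rwa [h4] at hadd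
  · rintro ⟨⟨i, j⟩, ⟨μ, ν⟩⟩ hs
    simp only [mem_sigma, HasAntidiagonal.mem_antidiagonal, mem_product, mem_filter,
      mem_piAntidiag_sym2] at hs
    obtain ⟨h1, ⟨⟨h2, h3⟩, h4, h5⟩, ⟨h6, h7⟩, h8⟩ := hs
    have hμ : inside (μ + ν) B = μ := by
      funext e
      by_cases he : e ∈ B.sym2
      · rw [inside_of_mem he, add_eq_left hdis h7 he]
      · rw [inside_of_notMem he]
        by_contra h
        exact he (h3 e (Ne.symm h))
    have hν : inside (μ + ν) (S \ B) = ν := by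
      funext e
      by_cases he : e ∈ (S \ B).sym2
      · rw [inside_of_mem he, add_comm, add_eq_left hdis.symm h3 he]
      · rw [inside_of_notMem he]
        by_contra h
        exact he (h7 e (Ne.symm h))
    simp only [hμ, hν, h2, h6]
  · intro μ hμ
    simp only [mem_filter, mem_piAntidiag_sym2] at hμ
    obtain ⟨⟨⟨h1, h2⟩, h3⟩, h4⟩ := hμ
    have hadd := inside_add_inside h2 v
    rw [h4] at hadd
    have := weight_add ω hdis (inside_support μ B) (inside_support μ (S \ B))
    rwa [hadd, hun] at this

open Classical in
/-- Decomposition according to the component of `v`. -/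
theorem total_eq_sum (ω : EdgeWeight) (Q : ℕ → ℕ → Prop) {S : Finset V} {v : V} (hv : v ∈ S) :
    total ω Q S = ∑ B ∈ S.powerset.filter (v ∈ ·), connected ω Q B * total ω Q (S \ B) := by
  have hmaps : ∀ m, ∀ μ ∈ (piAntidiag S.sym2 m).filter (CellsIn Q S),
      cell μ S v ∈ S.powerset.filter (v ∈ ·) := fun m μ _ => by
    rw [mem_filter, mem_powerset]
    exact ⟨fun w hw => (mem_cell.1 hw).1, mem_cell.2 ⟨hv, ReflTransGen.refl⟩⟩
  refine PowerSeries.ext fun m => ?_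
  rw [map_sum]
  calc PowerSeries.coeff m (total ω Q S)
      = ∑ μ ∈ (piAntidiag S.sym2 m).filter (CellsIn Q S), weight ω S μ :=
        PowerSeries.coeff_mk _ _
    _ = _ := (Finset.sum_fiberwise_of_maps_to (hmaps m) _).symm
    _ = _ := Finset.sum_congr rfl fun B hB => by
      rw [mem_filter, mem_powerset] at hB
      exact sum_cell_eq ω Q hB.2 hB.1 m

end Multiplicity

/-! ### Invariance under relabelling of vertices. -/

section Relabel

variable {V V' : Type*} (f : V ↪ V')

/-- The multiplicities seen through a relabelling. -/
def pull (μ : Sym2 V' → ℕ) : Sym2 V → ℕ := fun e => μ (e.map f)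

variable {f} {S : Finset V} {μ : Sym2 V' → ℕ}

theorem joined_pull (hμ : ∀ e, μ e ≠ 0 → e ∈ (S.map f).sym2) {v : V} {w' : V'} :
    Joined μ (f v) w' ↔ ∃ w, f w = w' ∧ Joined (pull f μ) v w := by
  constructor
  · intro h
    induction h with
    | refl => exact ⟨v, rfl, ReflTransGen.refl⟩
    | @tail b c _ hbc ih =>
      obtain ⟨w, rfl, hw⟩ := ih
      obtain ⟨u, -, rfl⟩ := mem_map.1 (mk_mem_sym2_iff.1 (hμ _ hbc)).2
      exact ⟨u, rfl, hw.tail hbc⟩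
  · rintro ⟨w, rfl, h⟩
    induction h with
    | refl => exact ReflTransGen.refl
    | tail _ hbc ih => exact ih.tail hbc

theorem joined_pull_iff (hμ : ∀ e, μ e ≠ 0 → e ∈ (S.map f).sym2) {v w : V} :
    Joined μ (f v) (f w) ↔ Joined (pull f μ) v w := by
  rw [joined_pull hμ]
  constructor
  · rintro ⟨u, hu, h⟩
    rwa [← f.injective hu]
  · exact fun h => ⟨w, rfl, h⟩

theorem cell_map (hμ : ∀ e, μ e ≠ 0 → e ∈ (S.map f).sym2) (v : V) :
    cell μ (S.map f) (f v) = (cell (pull f μ) S v).map f := by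
  ext w
  rw [mem_cell, mem_map, mem_map]
  constructor
  · rintro ⟨⟨u, hu, rfl⟩, h⟩
    exact ⟨u, mem_cell.2 ⟨hu, (joined_pull_iff hμ).1 h⟩, rfl⟩
  · rintro ⟨u, hu, rfl⟩
    exact ⟨⟨u, (mem_cell.1 hu).1, rfl⟩, (joined_pull_iff hμ).2 (mem_cell.1 hu).2⟩

theorem edgeCount_map (μ : Sym2 V' → ℕ) (B : Finset V) :
    edgeCount μ (B.map f) = edgeCount (pull f μ) B := by
  rw [edgeCount, sym2_map, sum_map]
  rfl

theorem cellsIn_map (hμ : ∀ e, μ e ≠ 0 → e ∈ (S.map f).sym2) (Q : ℕ → ℕ → Prop) :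
    CellsIn Q (S.map f) μ ↔ CellsIn Q S (pull f μ) := by
  rw [CellsIn, forall_mem_map]
  refine forall₂_congr fun v _ => ?_
  rw [cell_map hμ, card_map, edgeCount_map]

theorem isConn_map (hμ : ∀ e, μ e ≠ 0 → e ∈ (S.map f).sym2) :
    IsConn (S.map f) μ ↔ IsConn S (pull f μ) := by
  rw [IsConn, IsConn, map_nonempty, forall_mem_map]
  simp only [forall_mem_map, joined_pull_iff hμ]

theorem weight_map (ω : EdgeWeight) (μ : Sym2 V' → ℕ) (S : Finset V) :
    weight ω (S.map f) μ = weight ω S (pull f μ) := by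
  rw [weight, sym2_map, prod_map]
  refine Finset.prod_congr rfl fun e _ => ?_
  change ω.ofMult (e.map f) (μ (e.map f)) = ω.ofMult e (μ (e.map f))
  have h : (e.map f).IsDiag ↔ e.IsDiag := Sym2.isDiag_map f.injective
  rw [EdgeWeight.ofMult, EdgeWeight.ofMult]
  by_cases he : e.IsDiag
  · rw [if_pos (h.2 he), if_pos he]
  · rw [if_neg (fun h' => he (h.1 h')), if_neg he]

theorem pull_extend (μ : Sym2 V → ℕ) : pull f (Function.extend (Sym2.map f) μ 0) = μ := by
  funext e
  exact (Sym2.map.injective f.injective).extend_apply _ _ _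

theorem extend_pull (hμ : ∀ e, μ e ≠ 0 → e ∈ (S.map f).sym2) :
    Function.extend (Sym2.map f) (pull f μ) 0 = μ := by
  funext e
  by_cases h : ∃ e', Sym2.map f e' = e
  · obtain ⟨e', rfl⟩ := h
    exact (Sym2.map.injective f.injective).extend_apply _ _ _
  · rw [Function.extend_apply' _ _ _ h]
    by_contra h0
    have := hμ e (Ne.symm h0)
    rw [sym2_map, mem_map] at this
    obtain ⟨e', -, h1⟩ := this
    exact h ⟨e', h1⟩

theorem extend_support {μ : Sym2 V → ℕ} (hμ : ∀ e, μ e ≠ 0 → e ∈ S.sym2) :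
    ∀ e, Function.extend (Sym2.map f) μ 0 e ≠ 0 → e ∈ (S.map f).sym2 := by
  intro e he
  by_cases h : ∃ e', Sym2.map f e' = e
  · obtain ⟨e', rfl⟩ := h
    rw [(Sym2.map.injective f.injective).extend_apply] at he
    rw [sym2_map]
    exact mem_map_of_mem _ (hμ e' he)
  · rw [Function.extend_apply' _ _ _ h] at he
    exact absurd rfl he

theorem pull_support (hμ : ∀ e, μ e ≠ 0 → e ∈ (S.map f).sym2) :
    ∀ e, pull f μ e ≠ 0 → e ∈ S.sym2 := by
  intro e he
  have := hμ _ he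
  rw [sym2_map, mem_map] at this
  obtain ⟨e', h1, h2⟩ := this
  rwa [← Sym2.map.injective f.injective h2]

variable [DecidableEq V] [DecidableEq V']

theorem sum_weight_map (ω : EdgeWeight) (S : Finset V) (m : ℕ) {p' : (Sym2 V' → ℕ) → Prop}
    {p : (Sym2 V → ℕ) → Prop} [DecidablePred p'] [DecidablePred p]
    (hp : ∀ μ, (∀ e, μ e ≠ 0 → e ∈ (S.map f).sym2) → (p' μ ↔ p (pull f μ))) :
    ∑ μ ∈ (piAntidiag (S.map f).sym2 m).filter p', weight ω (S.map f) μ =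
      ∑ μ ∈ (piAntidiag S.sym2 m).filter p, weight ω S μ := by
  refine Finset.sum_bij' (fun μ _ => pull f μ) (fun μ _ => Function.extend (Sym2.map f) μ 0)
    ?_ ?_ ?_ ?_ ?_
  · intro μ hμ
    rw [mem_filter, mem_piAntidiag_sym2] at hμ ⊢
    exact ⟨⟨by rw [← edgeCount_map, hμ.1.1], pull_support hμ.1.2⟩, (hp μ hμ.1.2).1 hμ.2⟩
  · intro μ hμ
    rw [mem_filter, mem_piAntidiag_sym2] at hμ ⊢
    have hs := extend_support (f := f) hμ.1.2
    exact ⟨⟨by rw [edgeCount_map, pull_extend, hμ.1.1], hs⟩,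
      (hp _ hs).2 (by rw [pull_extend]; exact hμ.2)⟩
  · intro μ hμ
    rw [mem_filter, mem_piAntidiag_sym2] at hμ
    exact extend_pull hμ.1.2
  · intro μ _
    exact pull_extend μ
  · intro μ _
    exact weight_map ω μ S

variable (f)

theorem total_map (ω : EdgeWeight) (Q : ℕ → ℕ → Prop) (S : Finset V) :
    total ω Q (S.map f) = total ω Q S := by
  refine PowerSeries.ext fun m => ?_
  rw [total, total, PowerSeries.coeff_mk, PowerSeries.coeff_mk]
  classical
  exact sum_weight_map (f := f) (p' := CellsIn Q (S.map f)) (p := CellsIn Q S) ω S m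
    fun μ hμ => cellsIn_map hμ Q

theorem connected_map (ω : EdgeWeight) (Q : ℕ → ℕ → Prop) (S : Finset V) :
    connected ω Q (S.map f) = connected ω Q S := by
  refine PowerSeries.ext fun m => ?_
  rw [connected, connected, PowerSeries.coeff_mk, PowerSeries.coeff_mk]
  classical
  exact sum_weight_map (f := f) (p' := fun μ => IsConn (S.map f) μ ∧ Q (S.map f).card m)
    (p := fun μ => IsConn S μ ∧ Q S.card m) ω S m fun μ hμ => by rw [isConn_map hμ, card_map]

end Relabel

theorem exists_map_univ_fin {V : Type*} (S : Finset V) :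
    ∃ f : Fin S.card ↪ V, univ.map f = S := by
  refine ⟨S.equivFin.symm.toEmbedding.trans (Function.Embedding.subtype _), ?_⟩
  ext v
  simp only [mem_map, mem_univ, true_and]
  constructor
  · rintro ⟨i, rfl⟩
    exact (S.equivFin.symm i).2
  · exact fun hv => ⟨S.equivFin ⟨v, hv⟩, by simp⟩

/-- `total` on `n` vertices. -/
def totalFin (ω : EdgeWeight) (Q : ℕ → ℕ → Prop) (n : ℕ) : ℚ⟦X⟧ :=
  total ω Q (univ : Finset (Fin n))

/-- `connected` on `n` vertices. -/
def connectedFin (ω : EdgeWeight) (Q : ℕ → ℕ → Prop) (n : ℕ) : ℚ⟦X⟧ :=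
  connected ω Q (univ : Finset (Fin n))

theorem total_eq_totalFin {V : Type*} [DecidableEq V] (ω : EdgeWeight) (Q : ℕ → ℕ → Prop)
    (S : Finset V) : total ω Q S = totalFin ω Q S.card := by
  obtain ⟨f, hf⟩ := exists_map_univ_fin S
  conv_lhs => rw [← hf]
  rw [total_map, totalFin]

theorem connected_eq_connectedFin {V : Type*} [DecidableEq V] (ω : EdgeWeight)
    (Q : ℕ → ℕ → Prop) (S : Finset V) : connected ω Q S = connectedFin ω Q S.card := by
  obtain ⟨f, hf⟩ := exists_map_univ_fin S
  conv_lhs => rw [← hf]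
  rw [connected_map, connectedFin]

theorem sum_powerset_filter_mem {n : ℕ} {M : Type*} [AddCommMonoid M] (g : ℕ → M) :
    ∑ B ∈ (univ : Finset (Fin (n + 1))).powerset.filter (0 ∈ ·), g B.card =
      ∑ j ∈ range (n + 1), n.choose j • g (j + 1) := by
  have h := Finset.sum_powerset_apply_card (fun j => g (j + 1))
    (x := (univ : Finset (Fin (n + 1))).erase 0)
  rw [card_erase_of_mem (mem_univ _), card_univ, Fintype.card_fin, Nat.add_sub_cancel] at h
  rw [← h]
  refine Finset.sum_bij' (fun B _ => B.erase 0) (fun B _ => insert 0 B) ?_ ?_ ?_ ?_ ?_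
  · intro B _
    rw [mem_powerset]
    exact erase_subset_erase 0 (subset_univ _)
  · intro B _
    simp
  · intro B hB
    exact insert_erase (mem_filter.1 hB).2
  · intro B hB
    exact erase_insert fun h0 => by simpa using mem_powerset.1 hB h0
  · intro B hB
    rw [card_erase_of_mem (mem_filter.1 hB).2, Nat.sub_add_cancel]
    exact card_pos.2 ⟨0, (mem_filter.1 hB).2⟩

/-- The index j counts the other vertices in the component of vertex 0, chosen among the n remaining
ones. -/
theorem totalFin_succ (ω : EdgeWeight) (Q : ℕ → ℕ → Prop) (n : ℕ) :
    totalFin ω Q (n + 1) = ∑ j ∈ range (n + 1),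
      n.choose j • (connectedFin ω Q (j + 1) * totalFin ω Q (n - j)) := by
  have h := total_eq_sum ω Q (mem_univ (0 : Fin (n + 1)))
  rw [totalFin, h]
  have h2 : ∀ B ∈ (univ : Finset (Fin (n + 1))).powerset.filter (0 ∈ ·),
      connected ω Q B * total ω Q (univ \ B) =
        connectedFin ω Q B.card * totalFin ω Q (n + 1 - B.card) := fun B _ => by
    rw [connected_eq_connectedFin, total_eq_totalFin, card_sdiff_of_subset (subset_univ _),
      card_univ, Fintype.card_fin]
  convert (Finset.sum_congr rfl h2).trans
    (sum_powerset_filter_mem fun j => connectedFin ω Q j * totalFin ω Q (n + 1 - j)) using 3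
  rw [Nat.add_sub_add_right]

/-- Exponential generating function in `z` of a sequence of series in `w`. -/
def egf (a : ℕ → ℚ⟦X⟧) : ℚ⟦X⟧⟦X⟧ :=
  PowerSeries.mk fun n => PowerSeries.C (1 / (n ! : ℚ)) * a n

/-- The exponential formula. -/
theorem derivative_egf_totalFin (ω : EdgeWeight) (Q : ℕ → ℕ → Prop) :
    PowerSeries.derivative ℚ⟦X⟧ (egf (totalFin ω Q)) =
      PowerSeries.derivative ℚ⟦X⟧ (egf (connectedFin ω Q)) * egf (totalFin ω Q) := by
  have hder : ∀ (a : ℕ → ℚ⟦X⟧) (n : ℕ), PowerSeries.coeff n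
      (PowerSeries.derivative ℚ⟦X⟧ (egf a)) = PowerSeries.C (1 / (n ! : ℚ)) * a (n + 1) := by
    intro a n
    have hn : (n ! : ℚ) ≠ 0 := by exact_mod_cast Nat.factorial_ne_zero _
    have hn1 : (n : ℚ) + 1 ≠ 0 := by positivity
    rw [PowerSeries.coeff_derivative, egf, PowerSeries.coeff_mk,
      show (n : ℚ⟦X⟧) + 1 = PowerSeries.C ((n : ℚ) + 1) by simp, mul_right_comm, ← map_mul,
      Nat.factorial_succ]
    congr 2
    push_cast
    field_simp
  refine PowerSeries.ext fun n => ?_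
  -- After division by n!, the binomial convolution is the Cauchy product of exponential generating
  -- functions.
  rw [hder, totalFin_succ, PowerSeries.coeff_mul, Finset.Nat.sum_antidiagonal_eq_sum_range_succ
    (fun i j => PowerSeries.coeff i (PowerSeries.derivative ℚ⟦X⟧ (egf (connectedFin ω Q))) *
      PowerSeries.coeff j (egf (totalFin ω Q))), Finset.mul_sum]
  refine Finset.sum_congr rfl fun j hj => ?_
  have hjn : j ≤ n := by simpa [Nat.lt_succ_iff] using hj
  rw [hder, egf, PowerSeries.coeff_mk, nsmul_eq_mul, ← map_natCast (PowerSeries.C (R := ℚ)),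
    ← mul_assoc, ← map_mul, mul_mul_mul_comm, ← map_mul, Nat.cast_choose ℚ hjn]
  congr 2
  have hn : (n ! : ℚ) ≠ 0 := by exact_mod_cast Nat.factorial_ne_zero _
  field_simp

theorem totalFin_zero (ω : EdgeWeight) (Q : ℕ → ℕ → Prop) : totalFin ω Q 0 = 1 := by
  classical
  refine PowerSeries.ext fun m => ?_
  rw [totalFin, total, PowerSeries.coeff_mk, PowerSeries.coeff_one]
  have he : (univ : Finset (Fin 0)).sym2 = ∅ := by simp
  split_ifs with h
  · subst h
    have : (piAntidiag (univ : Finset (Fin 0)).sym2 0).filter (CellsIn Q univ) = {0} := by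
      ext μ
      rw [mem_filter, mem_singleton]
      constructor
      · intro _
        funext e
        exact isEmptyElim (α := Fin 0) (e.out.1)
      · rintro rfl
        exact ⟨by simp, fun v => v.elim0⟩
    rw [this, sum_singleton, weight, he, prod_empty]
  · refine sum_eq_zero fun μ hμ => ?_
    rw [mem_filter, mem_piAntidiag_sym2, edgeCount, he, sum_empty] at hμ
    exact absurd hμ.1.1.symm h

theorem connectedFin_zero (ω : EdgeWeight) (Q : ℕ → ℕ → Prop) : connectedFin ω Q 0 = 0 := by
  classical
  refine PowerSeries.ext fun m => ?_
  rw [connectedFin, connected, PowerSeries.coeff_mk, map_zero]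
  refine sum_eq_zero fun μ hμ => ?_
  obtain ⟨v, -⟩ := (mem_filter.1 hμ).2.1.1
  exact v.elim0

theorem constantCoeff_egf (a : ℕ → ℚ⟦X⟧) : PowerSeries.constantCoeff (egf a) = a 0 := by
  rw [← PowerSeries.coeff_zero_eq_constantCoeff_apply, egf, PowerSeries.coeff_mk]
  simp

/-- For a connected object the condition only concerns its numbers of vertices and edges, so
imposing it is a selection of monomials. -/
theorem positivePart_egf_connectedFin (ω : EdgeWeight) :
    positivePart (egf (connectedFin ω fun _ _ => True)) = egf (connectedFin ω (· < ·)) := by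
  classical
  refine PowerSeries.ext fun n => PowerSeries.ext fun m => ?_
  rw [positivePart, PowerSeries.coeff_mk, PowerSeries.coeff_mk, egf, egf, PowerSeries.coeff_mk,
    PowerSeries.coeff_mk, PowerSeries.coeff_C_mul, PowerSeries.coeff_C_mul, connectedFin,
    connectedFin, connected, connected, PowerSeries.coeff_mk, PowerSeries.coeff_mk]
  simp only [card_univ, Fintype.card_fin]
  split_ifs with h <;> simp [h]

/-! ### Simple graphs and multigraphs as multiplicity functions -/

/-- Weight `1` for simple graphs, `0` otherwise. -/
def simpleWeight : EdgeWeight where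
  diag k := if k = 0 then 1 else 0
  off k := if k ≤ 1 then 1 else 0
  diag_zero := rfl
  off_zero := rfl

/-- The weight of multigraphs with labelled oriented edges, after forgetting the labels and
orientations. -/
def multiWeight : EdgeWeight where
  diag k := (1 / 2) ^ k / (k ! : ℚ)
  off k := 1 / (k ! : ℚ)
  diag_zero := by simp
  off_zero := by simp

theorem ofMult_of_isDiag {V : Type*} (ω : EdgeWeight) {e : Sym2 V} (h : e.IsDiag) (k : ℕ) :
    ω.ofMult e k = ω.diag k := if_pos h

theorem ofMult_of_not_isDiag {V : Type*} (ω : EdgeWeight) {e : Sym2 V} (h : ¬ e.IsDiag) (k : ℕ) :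
    ω.ofMult e k = ω.off k := if_neg h

namespace Multigraph

variable {n m : ℕ}

/-- The multiplicity function of a multigraph. -/
def mult (G : Multigraph n m) (e : Sym2 (Fin n)) : ℕ :=
  (univ.filter fun i => s((G i).1, (G i).2) = e).card

theorem mult_mem_piAntidiag (G : Multigraph n m) : G.mult ∈ piAntidiag univ m := by
  rw [mem_piAntidiag]
  refine ⟨?_, fun _ _ => mem_univ _⟩
  have := card_eq_sum_card_fiberwise (s := (univ : Finset (Fin m)))
    (f := fun i => s((G i).1, (G i).2)) (t := univ) (fun _ _ => mem_coe.2 (mem_univ _))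
  rw [card_univ, Fintype.card_fin] at this
  exact this.symm

theorem prod_mult {M : Type*} [CommMonoid M] (G : Multigraph n m) (x : Sym2 (Fin n) → M) :
    ∏ i, x s((G i).1, (G i).2) = ∏ e, x e ^ G.mult e := by
  rw [← Finset.prod_fiberwise' univ (fun i => s((G i).1, (G i).2)) x]
  exact Finset.prod_congr rfl fun e _ => by rw [prod_const, mult]

end Multigraph

/-- The number of orientations of an edge. -/
def orientations {n : ℕ} (e : Sym2 (Fin n)) : ℕ :=
  (univ.filter fun p : Fin n × Fin n => s(p.1, p.2) = e).card

theorem orientations_of_isDiag {n : ℕ} {e : Sym2 (Fin n)} (h : e.IsDiag) :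
    orientations e = 1 := by
  induction e with
  | _ a b =>
    rw [Sym2.mk_isDiag_iff] at h
    subst h
    rw [orientations, card_eq_one]
    refine ⟨(a, a), ?_⟩
    ext p
    simp [Prod.ext_iff]

theorem orientations_of_not_isDiag {n : ℕ} {e : Sym2 (Fin n)} (h : ¬ e.IsDiag) :
    orientations e = 2 := by
  induction e with
  | _ a b =>
    rw [Sym2.mk_isDiag_iff] at h
    rw [orientations, card_eq_two]
    refine ⟨(a, b), (b, a), fun h' => h (Prod.ext_iff.1 h').1, ?_⟩
    ext p
    simp [Prod.ext_iff]

theorem orientations_pow_div (n : ℕ) (e : Sym2 (Fin n)) (k : ℕ) :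
    (orientations e : ℚ) ^ k / (k ! : ℚ) = 2 ^ k * multiWeight.ofMult e k := by
  by_cases h : e.IsDiag
  · rw [orientations_of_isDiag h, ofMult_of_isDiag _ h, multiWeight, ← mul_div_assoc, ← mul_pow]
    norm_num
  · rw [orientations_of_not_isDiag h, ofMult_of_not_isDiag _ h, multiWeight, mul_one_div]
    norm_num

/-- Compares the coefficients of the monomial of μ in two expansions of the m-th power of ∑ x_{vw}
over ordered pairs: over all choices of m pairs, which are the multigraphs, and by the multinomial
theorem after grouping the orientations of each edge. -/
theorem card_filter_mult_eq {n m : ℕ} {μ : Sym2 (Fin n) → ℕ} (hμ : μ ∈ piAntidiag univ m) :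
    ((univ.filter fun G : Multigraph n m => G.mult = μ).card : ℚ) =
      2 ^ m * (m ! : ℚ) * ∏ e, multiWeight.ofMult e (μ e) := by
  classical
  let x : Sym2 (Fin n) → MvPolynomial (Sym2 (Fin n)) ℚ := MvPolynomial.X
  have hmon : ∀ ν : Sym2 (Fin n) → ℕ, ∏ e, x e ^ ν e =
      MvPolynomial.monomial (Finsupp.equivFunOnFinite.symm ν) 1 := fun ν => by
    rw [MvPolynomial.monomial_eq, map_one, one_mul, Finsupp.prod_fintype _ _ (by simp)]
    rfl
  have h1 : (∑ p : Fin n × Fin n, x s(p.1, p.2)) ^ m =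
      ∑ G : Multigraph n m, MvPolynomial.monomial (Finsupp.equivFunOnFinite.symm G.mult) 1 := by
    rw [Fintype.sum_pow]
    exact Finset.sum_congr rfl fun G _ => by rw [Multigraph.prod_mult G x, hmon]
  have h2 : ∑ p : Fin n × Fin n, x s(p.1, p.2) = ∑ e, (orientations e : ℚ) • x e := by
    rw [← Finset.sum_fiberwise' univ (fun p : Fin n × Fin n => s(p.1, p.2)) x]
    exact Finset.sum_congr rfl fun e _ => by
      rw [sum_const, orientations, Nat.cast_smul_eq_nsmul]
  have h3 : (∑ e, (orientations e : ℚ) • x e) ^ m = ∑ ν ∈ piAntidiag univ m,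
      MvPolynomial.monomial (Finsupp.equivFunOnFinite.symm ν)
        ((Nat.multinomial univ ν : ℚ) * ∏ e, (orientations e : ℚ) ^ ν e) := by
    rw [sum_pow_eq_sum_piAntidiag]
    refine Finset.sum_congr rfl fun ν _ => ?_
    simp only [smul_pow]
    rw [Finset.prod_smul, hmon, MvPolynomial.smul_monomial, ← nsmul_eq_mul,
      ← Nat.cast_smul_eq_nsmul ℚ, MvPolynomial.smul_monomial]
    simp
  have h4 := congrArg (MvPolynomial.coeff (Finsupp.equivFunOnFinite.symm μ))
    (h1.symm.trans ((congrArg (· ^ m) h2).trans h3))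
  simp only [MvPolynomial.coeff_sum, MvPolynomial.coeff_monomial,
    EmbeddingLike.apply_eq_iff_eq] at h4
  rw [Finset.sum_ite_eq' , if_pos hμ, Finset.sum_boole] at h4
  rw [h4]
  have hm := (mem_piAntidiag.1 hμ).1
  have hspec := Nat.multinomial_spec univ μ
  rw [hm] at hspec
  have hf : ∏ e, ((μ e)! : ℚ) ≠ 0 :=
    Finset.prod_ne_zero_iff.2 fun e _ => by exact_mod_cast Nat.factorial_ne_zero _
  have h5 : (∏ e, multiWeight.ofMult e (μ e)) * 2 ^ m * (∏ e, ((μ e)! : ℚ)) =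
      ∏ e, (orientations e : ℚ) ^ μ e := by
    have h2m : (2 : ℚ) ^ m = ∏ e, 2 ^ μ e := by rw [Finset.prod_pow_eq_pow_sum, hm]
    rw [h2m, ← Finset.prod_mul_distrib, ← Finset.prod_mul_distrib]
    refine Finset.prod_congr rfl fun e _ => ?_
    have he : ((μ e)! : ℚ) ≠ 0 := by exact_mod_cast Nat.factorial_ne_zero _
    have := orientations_pow_div n e (μ e)
    rw [div_eq_iff he] at this
    rw [this]
    ring
  have hspec' : (∏ e, ((μ e)! : ℚ)) * (Nat.multinomial univ μ : ℚ) = (m ! : ℚ) := by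
    exact_mod_cast hspec
  rw [← h5, ← hspec']
  ring

/-- Counting multigraphs by their multiplicity functions. -/
theorem ncard_multigraph {n m : ℕ} (p : Multigraph n m → Prop) (q : (Sym2 (Fin n) → ℕ) → Prop)
    [DecidablePred q] (hpq : ∀ G, p G ↔ q G.mult) :
    (({G | p G} : Set (Multigraph n m)).ncard : ℚ) = 2 ^ m * (m ! : ℚ) *
      ∑ μ ∈ (piAntidiag (univ : Finset (Fin n)).sym2 m).filter q, weight multiWeight univ μ := by
  classical
  have h1 : ({G | p G} : Set (Multigraph n m)) =
      ((univ.filter fun G : Multigraph n m => q G.mult : Finset (Multigraph n m)) : Set _) := by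
    ext G
    simp [hpq]
  have hmaps : ∀ G ∈ univ.filter fun G : Multigraph n m => q G.mult,
      G.mult ∈ (piAntidiag (univ : Finset (Fin n)).sym2 m).filter q := fun G hG => by
    rw [mem_filter] at hG ⊢
    rw [sym2_univ]
    exact ⟨G.mult_mem_piAntidiag, hG.2⟩
  rw [h1, Set.ncard_coe_finset, card_eq_sum_card_fiberwise hmaps, Finset.mul_sum]
  push_cast
  refine Finset.sum_congr rfl fun μ hμ => ?_
  rw [mem_filter, sym2_univ] at hμ
  rw [weight, sym2_univ, ← card_filter_mult_eq hμ.1, filter_filter]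
  congr 2
  ext G
  simp only [mem_filter, mem_univ, true_and, and_iff_right_iff_imp]
  rintro rfl
  exact hμ.2

open Classical in
/-- The multiplicity function of a simple graph. -/
def simpleMult {V : Type*} (G : SimpleGraph V) (e : Sym2 V) : ℕ := if e ∈ G.edgeSet then 1 else 0

theorem simpleMult_ne_zero {V : Type*} {G : SimpleGraph V} {e : Sym2 V} :
    simpleMult G e ≠ 0 ↔ e ∈ G.edgeSet := by
  rw [simpleMult]
  split_ifs with h <;> simp [h]

theorem simpleMult_injective {V : Type*} :
    Function.Injective (simpleMult : SimpleGraph V → Sym2 V → ℕ) := by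
  intro G H h
  refine SimpleGraph.edgeSet_injective (Set.ext fun e => ?_)
  rw [← simpleMult_ne_zero, h, simpleMult_ne_zero]

/-- No loops and no multiple edges. -/
def IsSimple {V : Type*} (μ : Sym2 V → ℕ) : Prop :=
  ∀ e, (e.IsDiag → μ e = 0) ∧ μ e ≤ 1

theorem isSimple_simpleMult {V : Type*} (G : SimpleGraph V) : IsSimple (simpleMult G) := by
  refine fun e => ⟨fun h => ?_, ?_⟩
  · by_contra h'
    exact G.not_isDiag_of_mem_edgeSet (simpleMult_ne_zero.1 h') h
  · rw [simpleMult]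
    split_ifs <;> omega

theorem exists_simpleMult_eq {V : Type*} {μ : Sym2 V → ℕ} (h : IsSimple μ) :
    ∃ G : SimpleGraph V, simpleMult G = μ := by
  refine ⟨SimpleGraph.fromEdgeSet {e | μ e ≠ 0}, funext fun e => ?_⟩
  have h1 := (h e).2
  by_cases h0 : μ e = 0
  · rw [h0]
    by_contra h'
    have := simpleMult_ne_zero.1 h'
    rw [SimpleGraph.edgeSet_fromEdgeSet] at this
    exact this.1 h0
  · have : e ∈ (SimpleGraph.fromEdgeSet {e | μ e ≠ 0}).edgeSet := by
      rw [SimpleGraph.edgeSet_fromEdgeSet]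
      exact ⟨h0, fun hd => h0 ((h e).1 hd)⟩
    rw [simpleMult, if_pos this]
    omega

open Classical in
theorem weight_simple {n : ℕ} (μ : Sym2 (Fin n) → ℕ) :
    weight simpleWeight univ μ = if IsSimple μ then 1 else 0 := by
  rw [weight, sym2_univ]
  have h : ∀ e : Sym2 (Fin n), simpleWeight.ofMult e (μ e) =
      if (e.IsDiag → μ e = 0) ∧ μ e ≤ 1 then 1 else 0 := fun e => by
    by_cases he : e.IsDiag
    · rw [ofMult_of_isDiag _ he, simpleWeight]
      by_cases h0 : μ e = 0 <;> simp [h0, he]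
    · rw [ofMult_of_not_isDiag _ he, simpleWeight]
      by_cases h0 : μ e ≤ 1 <;> simp [h0, he]
  simp only [h]
  rw [Finset.prod_boole]
  by_cases hs : IsSimple μ
  · rw [if_pos hs, if_pos fun e _ => hs e]
  · rw [if_neg hs, if_neg fun h' => hs fun e => h' e (mem_univ e)]

theorem edgeCount_simpleMult {n : ℕ} (G : SimpleGraph (Fin n)) (B : Finset (Fin n)) :
    edgeCount (simpleMult G) B = {e | e ∈ G.edgeSet ∧ e ∈ B.sym2}.ncard := by
  classical
  have : {e | e ∈ G.edgeSet ∧ e ∈ B.sym2} =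
      ((B.sym2.filter fun e => e ∈ G.edgeSet : Finset (Sym2 (Fin n))) : Set _) := by
    ext e
    simp [and_comm]
  rw [this, Set.ncard_coe_finset, card_filter]
  rfl

/-- Counting simple graphs by their multiplicity functions. -/
theorem ncard_simpleGraph {n m : ℕ} (p : SimpleGraph (Fin n) → Prop)
    (q : (Sym2 (Fin n) → ℕ) → Prop) [DecidablePred q] (hpq : ∀ G, p G ↔ q (simpleMult G)) :
    (({G | p G ∧ G.edgeSet.ncard = m} : Set (SimpleGraph (Fin n))).ncard : ℚ) =
      ∑ μ ∈ (piAntidiag (univ : Finset (Fin n)).sym2 m).filter q, weight simpleWeight univ μ := by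
  classical
  have hm : ∀ G : SimpleGraph (Fin n), simpleMult G ∈ piAntidiag (univ : Finset (Fin n)).sym2 m ↔
      G.edgeSet.ncard = m := fun G => by
    rw [mem_piAntidiag_sym2, edgeCount_simpleMult]
    simp
  have h1 : (({G | p G ∧ G.edgeSet.ncard = m} : Set (SimpleGraph (Fin n))).ncard) =
      ((piAntidiag (univ : Finset (Fin n)).sym2 m).filter fun μ => q μ ∧ IsSimple μ).card := by
    rw [← Set.ncard_coe_finset, ← Set.ncard_image_of_injective _ simpleMult_injective]
    congr 1
    ext μ
    simp only [Set.mem_image, Set.mem_ofPred_eq, mem_coe, mem_filter]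
    constructor
    · rintro ⟨G, ⟨h1, h2⟩, rfl⟩
      exact ⟨(hm G).2 h2, (hpq G).1 h1, isSimple_simpleMult G⟩
    · rintro ⟨h1, h2, h3⟩
      obtain ⟨G, rfl⟩ := exists_simpleMult_eq h3
      exact ⟨G, ⟨(hpq G).2 h2, (hm G).1 h1⟩, rfl⟩
  rw [h1]
  simp only [weight_simple]
  rw [Finset.sum_boole, filter_filter]

/-! ### Translation of graph-theoretic notions to multiplicity functions. -/

section Bridge

variable {n m : ℕ}

/-- Loops only add steps that stay in place, so agreement off the diagonal is enough. -/
theorem joined_iff_reachable {V : Type*} {G : SimpleGraph V} {μ : Sym2 V → ℕ}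
    (h : ∀ v w, v ≠ w → (μ s(v, w) ≠ 0 ↔ G.Adj v w)) {v w : V} :
    Joined μ v w ↔ G.Reachable v w := by
  rw [SimpleGraph.reachable_iff_reflTransGen]
  constructor
  · intro hj
    induction hj with
    | refl => exact ReflTransGen.refl
    | @tail b c _ hbc ih =>
      by_cases hne : b = c
      · rwa [← hne]
      · exact ih.tail ((h b c hne).1 hbc)
  · intro hj
    induction hj with
    | refl => exact ReflTransGen.refl
    | tail _ hbc ih => exact ih.tail ((h _ _ hbc.ne).2 hbc)

theorem simpleMult_adj {V : Type*} (G : SimpleGraph V) (v w : V) (_ : v ≠ w) :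
    simpleMult G s(v, w) ≠ 0 ↔ G.Adj v w := by
  rw [simpleMult_ne_zero, SimpleGraph.mem_edgeSet]

theorem mult_adj (G : Multigraph n m) (v w : Fin n) (hvw : v ≠ w) :
    G.mult s(v, w) ≠ 0 ↔ G.underlying.Adj v w := by
  rw [Multigraph.underlying, SimpleGraph.fromRel_adj, Multigraph.mult, card_ne_zero]
  constructor
  · rintro ⟨i, hi⟩
    have := (mem_filter.1 hi).2
    rcases Sym2.eq_iff.1 this with ⟨h1, h2⟩ | ⟨h1, h2⟩
    · exact ⟨hvw, Or.inl ⟨i, Prod.ext h1 h2⟩⟩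
    · exact ⟨hvw, Or.inr ⟨i, Prod.ext h1 h2⟩⟩
  · rintro ⟨-, ⟨i, hi⟩ | ⟨i, hi⟩⟩
    · exact ⟨i, mem_filter.2 ⟨mem_univ _, by rw [hi]⟩⟩
    · exact ⟨i, mem_filter.2 ⟨mem_univ _, by rw [hi, Sym2.eq_swap]⟩⟩

theorem isConn_univ_iff {G : SimpleGraph (Fin n)} {μ : Sym2 (Fin n) → ℕ}
    (h : ∀ v w, v ≠ w → (μ s(v, w) ≠ 0 ↔ G.Adj v w)) : G.Connected ↔ IsConn univ μ := by
  rw [SimpleGraph.connected_iff, IsConn, univ_nonempty_iff, and_comm]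
  simp only [mem_univ, true_implies, joined_iff_reachable h]
  rfl

theorem coe_cell_univ {G : SimpleGraph (Fin n)} {μ : Sym2 (Fin n) → ℕ}
    (h : ∀ v w, v ≠ w → (μ s(v, w) ≠ 0 ↔ G.Adj v w)) (v : Fin n) :
    (cell μ univ v : Set (Fin n)) = (G.connectedComponentMk v).supp := by
  ext w
  rw [mem_coe, mem_cell, SimpleGraph.ConnectedComponent.mem_supp_iff,
    SimpleGraph.ConnectedComponent.eq, joined_iff_reachable h]
  exact ⟨fun h => h.2.symm, fun h => ⟨mem_univ _, h.symm⟩⟩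

/-- The excess is kept abstract because graphs and multigraphs define that of a component
differently. -/
theorem forall_component_iff {G : SimpleGraph (Fin n)} {μ : Sym2 (Fin n) → ℕ}
    (h : ∀ v w, v ≠ w → (μ s(v, w) ≠ 0 ↔ G.Adj v w)) (e : G.ConnectedComponent → ℤ)
    (he : ∀ (c : G.ConnectedComponent) (B : Finset (Fin n)), (B : Set (Fin n)) = c.supp →
      e c = edgeCount μ B - B.card) :
    (∀ c, 0 < e c) ↔ CellsIn (· < ·) univ μ := by
  constructor
  · intro hc v _
    have := hc (G.connectedComponentMk v)
    rw [he _ _ (coe_cell_univ h v)] at this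
    omega
  · intro hc c
    induction c using SimpleGraph.ConnectedComponent.ind with
    | _ v =>
      rw [he _ _ (coe_cell_univ h v)]
      have := hc v (mem_univ v)
      omega

theorem ncard_edgeSet_toSimpleGraph {G : SimpleGraph (Fin n)} (c : G.ConnectedComponent)
    (B : Finset (Fin n)) (hB : (B : Set (Fin n)) = c.supp) :
    c.toSimpleGraph.edgeSet.ncard = edgeCount (simpleMult G) B := by
  rw [edgeCount_simpleMult, ← Set.ncard_image_of_injective _
    (Sym2.map.injective (Subtype.val_injective (p := (· ∈ c)))) ]
  congr 1
  ext e
  induction e with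
  | _ a b =>
    have hmem : ∀ x, x ∈ B ↔ x ∈ c := fun x => by
      rw [← mem_coe, hB]; rfl
    simp only [Set.mem_image, Set.mem_ofPred_eq, SimpleGraph.mem_edgeSet, mk_mem_sym2_iff, hmem]
    constructor
    · rintro ⟨e', he', h⟩
      induction e' with
      | _ x y =>
        have he'' : G.Adj x y := he'
        rw [Sym2.map_mk, Sym2.eq_iff] at h
        rcases h with ⟨rfl, rfl⟩ | ⟨rfl, rfl⟩
        · exact ⟨he'', x.2, y.2⟩
        · exact ⟨he''.symm, y.2, x.2⟩
    · rintro ⟨h1, h2, h3⟩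
      exact ⟨s(⟨a, h2⟩, ⟨b, h3⟩), h1, rfl⟩

theorem posGraphs_iff (G : SimpleGraph (Fin n)) :
    G ∈ posGraphs n ↔ CellsIn (· < ·) univ (simpleMult G) := by
  refine forall_component_iff (simpleMult_adj G) _ fun c B hB => ?_
  rw [graphExcess, ncard_edgeSet_toSimpleGraph c B hB]
  congr 2
  rw [← Set.ncard_coe_finset B, hB]
  rfl

theorem edgeCount_mult (G : Multigraph n m) (B : Finset (Fin n)) :
    edgeCount G.mult B = {e : Fin m | (G e).1 ∈ B ∧ (G e).2 ∈ B}.ncard := by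
  classical
  have : {e : Fin m | (G e).1 ∈ B ∧ (G e).2 ∈ B} =
      ((univ.filter fun e : Fin m => s((G e).1, (G e).2) ∈ B.sym2 : Finset (Fin m)) : Set _) := by
    ext e
    simp
  rw [this, Set.ncard_coe_finset,
    card_eq_sum_card_fiberwise (f := fun i => s((G i).1, (G i).2)) (t := B.sym2)
      (fun i hi => mem_coe.2 (mem_filter.1 (mem_coe.1 hi)).2), edgeCount]
  refine Finset.sum_congr rfl fun e he => ?_
  rw [Multigraph.mult, filter_filter]
  congr 1
  ext i
  simp only [mem_filter, mem_univ, true_and]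
  constructor
  · rintro rfl
    exact ⟨he, rfl⟩
  · exact fun h => h.2

theorem posMultigraphs_iff (G : Multigraph n m) :
    G ∈ posMultigraphs n m ↔ CellsIn (· < ·) univ G.mult := by
  refine forall_component_iff (mult_adj G) _ fun c B hB => ?_
  rw [Multigraph.componentExcess, edgeCount_mult, ← hB, Set.ncard_coe_finset]
  rfl

theorem coeff_graphGF (F : ∀ n, Set (SimpleGraph (Fin n))) (n m : ℕ) :
    PowerSeries.coeff m (PowerSeries.coeff n (graphGF F)) =
      (({G : SimpleGraph (Fin n) | G ∈ F n ∧ G.edgeSet.ncard = m}.ncard : ℕ) : ℚ) / (n ! : ℚ) := by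
  rw [graphGF, PowerSeries.coeff_mk, PowerSeries.coeff_mk]

theorem coeff_multigraphGF (F : ∀ n m, Set (Multigraph n m)) (n m : ℕ) :
    PowerSeries.coeff m (PowerSeries.coeff n (multigraphGF F)) =
      (((F n m).ncard : ℕ) : ℚ) / (2 ^ m * (m ! : ℚ) * (n ! : ℚ)) := by
  rw [multigraphGF, PowerSeries.coeff_mk, PowerSeries.coeff_mk]

theorem coeff_egf (a : ℕ → ℚ⟦X⟧) (n m : ℕ) :
    PowerSeries.coeff m (PowerSeries.coeff n (egf a)) = PowerSeries.coeff m (a n) / (n ! : ℚ) := by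
  rw [egf, PowerSeries.coeff_mk, PowerSeries.coeff_C_mul]
  ring

theorem graphGF_posGraphs : graphGF posGraphs = egf (totalFin simpleWeight (· < ·)) := by
  classical
  refine PowerSeries.ext fun n => PowerSeries.ext fun m => ?_
  rw [coeff_graphGF, coeff_egf, totalFin, total, PowerSeries.coeff_mk,
    ncard_simpleGraph (· ∈ posGraphs n) _ posGraphs_iff]

theorem multigraphGF_posMultigraphs :
    multigraphGF posMultigraphs = egf (totalFin multiWeight (· < ·)) := by
  classical
  refine PowerSeries.ext fun n => PowerSeries.ext fun m => ?_
  have h := ncard_multigraph (· ∈ posMultigraphs n m) _ posMultigraphs_iff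
  have hm : (m ! : ℚ) ≠ 0 := by exact_mod_cast Nat.factorial_ne_zero _
  rw [coeff_multigraphGF, coeff_egf, totalFin, total, PowerSeries.coeff_mk,
    show (posMultigraphs n m).ncard = ({G | G ∈ posMultigraphs n m} : Set _).ncard from rfl, h]
  field_simp

/-- The logarithm of the series of all graphs. -/
def simpleLog : ℚ⟦X⟧⟦X⟧ := egf (connectedFin simpleWeight fun _ _ => True)

/-- The logarithm of the series of all multigraphs. -/
def multiLog : ℚ⟦X⟧⟦X⟧ := egf (connectedFin multiWeight fun _ _ => True)

theorem coeff_simpleLog (n m : ℕ) : PowerSeries.coeff m (PowerSeries.coeff n simpleLog) =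
    (({G : SimpleGraph (Fin n) | G.Connected ∧ G.edgeSet.ncard = m}.ncard : ℕ) : ℚ) /
      (n ! : ℚ) := by
  classical
  rw [simpleLog, coeff_egf, connectedFin, connected, PowerSeries.coeff_mk]
  rw [ncard_simpleGraph (fun G => G.Connected) (fun μ => IsConn univ μ ∧ True)
    fun G => (isConn_univ_iff (simpleMult_adj G)).trans
    (and_true _).to_iff.symm]
  congr!

theorem excessPart_simpleLog : excessPart simpleLog 0 = unicycleGF := by
  refine PowerSeries.ext fun n => ?_
  rw [unicycleGF, coeff_excessPart, coeff_excessPart, coeff_simpleLog, coeff_graphGF]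
  congr 3
  ext G
  simp only [unicycles, graphExcess, Set.mem_ofPred_eq, Nat.card_eq_fintype_card,
    Fintype.card_fin]
  constructor
  · rintro ⟨h1, h2⟩
    exact ⟨⟨h1, by omega⟩, h2⟩
  · rintro ⟨⟨h1, -⟩, h2⟩
    exact ⟨h1, h2⟩

theorem excessPart_multiLog : excessPart multiLog 0 = multiUnicycleGF := by
  classical
  refine PowerSeries.ext fun n => ?_
  have hn : (n ! : ℚ) ≠ 0 := by exact_mod_cast Nat.factorial_ne_zero _
  have hset : (multiUnicycles n (n + 0)) =
      {G : Multigraph n (n + 0) | G.underlying.Connected} := by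
    ext G
    simp [multiUnicycles]
  have h := ncard_multigraph (fun G : Multigraph n (n + 0) => G.underlying.Connected)
    (fun μ => IsConn univ μ ∧ True)
    fun G => (isConn_univ_iff (mult_adj G)).trans (and_true _).to_iff.symm
  rw [multiUnicycleGF, coeff_excessPart, coeff_excessPart, coeff_multigraphGF, multiLog, coeff_egf,
    connectedFin, connected, PowerSeries.coeff_mk, hset, h]
  rw [add_zero]
  field_simp
  congr!

/-- Trees are the connected graphs of excess -1, and each vertex may be the root. -/
theorem coeff_rootedTreeGF (n : ℕ) : PowerSeries.coeff (n + 1) rootedTreeGF =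
    ((n + 1 : ℕ) : ℚ) * PowerSeries.coeff n (PowerSeries.coeff (n + 1) simpleLog) := by
  rw [rootedTreeGF, PowerSeries.coeff_mk, coeff_simpleLog]
  have h : {p : SimpleGraph (Fin (n + 1)) × Fin (n + 1) | p.1.IsTree} =
      {G : SimpleGraph (Fin (n + 1)) | G.Connected ∧ G.edgeSet.ncard = n} ×ˢ
        (Set.univ : Set (Fin (n + 1))) := by
    ext p
    simp only [Set.mem_ofPred_eq, Set.mem_prod, Set.mem_univ, and_true,
      SimpleGraph.isTree_iff_connected_and_card, Nat.card_coe_set_eq,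
      Nat.card_eq_fintype_card, Fintype.card_fin, Nat.add_right_cancel_iff]
  rw [h, Set.ncard_prod, Set.ncard_univ, Nat.card_eq_fintype_card, Fintype.card_fin]
  push_cast
  ring

/-- Every simple graph comes from at least `2 ^ m * m!` multigraphs. -/
theorem weight_simple_le_weight_multi (μ : Sym2 (Fin n) → ℕ) :
    weight simpleWeight univ μ ≤ weight multiWeight univ μ := by
  refine Finset.prod_le_prod (fun e _ => ?_) fun e _ => ?_ <;>
  · by_cases he : e.IsDiag
    · simp only [ofMult_of_isDiag _ he, simpleWeight, multiWeight]
      split_ifs with h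
      · simp [h]
      · positivity
    · simp only [ofMult_of_not_isDiag _ he, simpleWeight, multiWeight]
      split_ifs with h
      · interval_cases μ e <;> simp
      · positivity

theorem coeff_totalFin_le (Q : ℕ → ℕ → Prop) (n m : ℕ) :
    PowerSeries.coeff m (totalFin simpleWeight Q n) ≤
      PowerSeries.coeff m (totalFin multiWeight Q n) := by
  rw [totalFin, totalFin, total, total, PowerSeries.coeff_mk, PowerSeries.coeff_mk]
  exact Finset.sum_le_sum fun μ _ => weight_simple_le_weight_multi μ

/-- Each of the m labelled edges is one of n² ordered pairs, giving n^{2m}/(2^m m!). -/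
theorem totalFin_multi_true (n : ℕ) : totalFin multiWeight (fun _ _ => True) n = gaussExp n := by
  classical
  refine PowerSeries.ext fun m => ?_
  have h := ncard_multigraph (fun _ : Multigraph n m => True)
    (CellsIn (fun _ _ => True) univ) fun _ => ⟨fun _ _ _ => trivial, fun _ => trivial⟩
  have h2 : ({G | True} : Set (Multigraph n m)).ncard = (n * n) ^ m := by
    rw [show ({G | True} : Set (Multigraph n m)) = Set.univ from rfl, Set.ncard_univ,
      Nat.card_eq_fintype_card]
    simp [Multigraph]
  have hm : (m ! : ℚ) ≠ 0 := by exact_mod_cast Nat.factorial_ne_zero _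
  rw [h2] at h
  rw [totalFin, total, PowerSeries.coeff_mk, gaussExp, coeff_rescale_exp, smul_eq_mul, div_pow]
  push_cast at h
  rw [← pow_two] at h
  field_simp
  rw [h]
  ring

end Bridge

/-! ### Patchworks -/

section Patchwork

variable {n m : ℕ}

theorem mem_edges {G : Multigraph n m} {t : Fin n × Fin n × Fin m} :
    t ∈ G.edges ↔ G t.2.2 = (t.1, t.2.1) := by
  obtain ⟨v, w, e⟩ := t
  simp only [Multigraph.edges, mem_image, mem_univ, true_and, Prod.mk.injEq]
  constructor
  · rintro ⟨i, h1, h2, rfl⟩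
    exact Prod.ext h1 h2
  · intro h
    exact ⟨e, by rw [h], by rw [h], rfl⟩

/-- A loop or a double edge. -/
def IsPart (p : Part n m) : Prop := IsLoop p ∨ IsDoubleEdge p

/-- The parts are loops and double edges, and edges with the same label are equal. -/
def IsValid (P : Finset (Part n m)) : Prop :=
  (∀ p ∈ P, IsPart p) ∧
    ∀ t ∈ P.sup Prod.snd, ∀ t' ∈ P.sup Prod.snd, t.2.2 = t'.2.2 → t = t'

/-- The labels used by a set of parts. -/
def labels (P : Finset (Part n m)) : Finset (Fin m) := (P.sup Prod.snd).image fun t => t.2.2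

theorem forall_mem_LD_iff {P : Finset (Part n m)} {G : Multigraph n m} :
    (∀ p ∈ P, p ∈ LD G) ↔ (∀ p ∈ P, IsPart p) ∧ P.sup Prod.snd ⊆ G.edges := by
  rw [Finset.sup_le_iff]
  exact ⟨fun h => ⟨fun p hp => (h p hp).2, fun p hp => (h p hp).1⟩,
    fun h p hp => ⟨h.2 p hp, h.1 p hp⟩⟩

theorem eq_of_mem_edges {G : Multigraph n m} {t t' : Fin n × Fin n × Fin m} (ht : t ∈ G.edges)
    (ht' : t' ∈ G.edges) (h : t.2.2 = t'.2.2) : t = t' := by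
  rw [mem_edges] at ht ht'
  rw [h, ht'] at ht
  obtain ⟨h1, h2⟩ := Prod.ext_iff.1 ht
  exact Prod.ext h1.symm (Prod.ext h2.symm h)

/-- The multigraph of a patchwork is determined by its parts: it exists once equal labels mean equal
edges and every label is used. `IsValid` keeps the conditions that do not require covering all
vertices and labels. -/
theorem isPatchwork_iff {P : Finset (Part n m)} :
    IsPatchwork P ↔ IsValid P ∧ P.sup Prod.fst = univ ∧ labels P = univ := by
  constructor
  · rintro ⟨G, h1, h2, h3⟩
    have h4 := forall_mem_LD_iff.1 h3
    refine ⟨⟨h4.1, fun t ht t' ht' => eq_of_mem_edges (h4.2 ht) (h4.2 ht')⟩, h1, ?_⟩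
    rw [labels, h2, eq_univ_iff_forall]
    intro e
    exact mem_image.2 ⟨((G e).1, (G e).2, e), mem_edges.2 rfl, rfl⟩
  · rintro ⟨⟨h1, h2⟩, h3, h4⟩
    have hex : ∀ e : Fin m, ∃ t ∈ P.sup Prod.snd, t.2.2 = e := fun e => by
      have := mem_univ e
      rw [← h4, labels, mem_image] at this
      exact this
    choose t ht hte using hex
    have hsub : P.sup Prod.snd = Multigraph.edges fun e => ((t e).1, (t e).2.1) := by
      ext x
      rw [mem_edges]
      constructor
      · intro hx
        rw [h2 _ (ht x.2.2) x hx (hte x.2.2)]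
      · intro hx
        have : x = t x.2.2 := by
          obtain ⟨h1, h2⟩ := Prod.ext_iff.1 hx
          exact Prod.ext h1.symm (Prod.ext h2.symm (hte _).symm)
        rw [this]
        exact ht _
    exact ⟨fun e => ((t e).1, (t e).2.1), h3, hsub,
      forall_mem_LD_iff.2 ⟨h1, hsub.le⟩⟩

/-- The edges with a label in E are forced, and each remaining label has n² choices. -/
theorem card_filter_subset_edges {E : Finset (Fin n × Fin n × Fin m)}
    (hE : ∀ t ∈ E, ∀ t' ∈ E, t.2.2 = t'.2.2 → t = t') :
    (univ.filter fun G : Multigraph n m => E ⊆ G.edges).card =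
      (n * n) ^ (m - (E.image fun t => t.2.2).card) := by
  classical
  have h : (univ.filter fun G : Multigraph n m => E ⊆ G.edges) =
      Fintype.piFinset fun e => univ.filter fun p : Fin n × Fin n =>
        ∀ t ∈ E, t.2.2 = e → p = (t.1, t.2.1) := by
    ext G
    simp only [mem_filter, mem_univ, true_and, Fintype.mem_piFinset, Finset.subset_iff, mem_edges]
    exact ⟨fun h e t ht he => by rw [← he]; exact h ht, fun h t ht => h _ t ht rfl⟩
  have hc : ∀ e, (univ.filter fun p : Fin n × Fin n =>
      ∀ t ∈ E, t.2.2 = e → p = (t.1, t.2.1)).card =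
        if e ∈ E.image fun t => t.2.2 then 1 else n * n := fun e => by
    split_ifs with he
    · obtain ⟨t, ht, rfl⟩ := mem_image.1 he
      rw [card_eq_one]
      refine ⟨(t.1, t.2.1), ?_⟩
      ext p
      simp only [mem_filter, mem_univ, true_and, mem_singleton]
      refine ⟨fun h => h t ht rfl, ?_⟩
      rintro rfl t' ht' h
      rw [hE t ht t' ht' h.symm]
    · rw [filter_true_of_mem, card_univ]
      · simp
      · intro p _ t ht hte
        exact absurd (mem_image.2 ⟨t, ht, hte⟩) he
  rw [h, Fintype.card_piFinset]
  simp only [hc]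
  rw [Finset.prod_ite, prod_const_one, one_mul, prod_const, filter_not, filter_mem_eq_inter,
    univ_inter, card_sdiff_of_subset (subset_univ _), card_univ, Fintype.card_fin]

theorem LD_eq_empty_iff (G : Multigraph n m) : LD G = ∅ ↔ IsSimple G.mult := by
  have hmem : ∀ (e : Sym2 (Fin n)) i, i ∈ (univ.filter fun i => s((G i).1, (G i).2) = e) ↔
      s((G i).1, (G i).2) = e := fun e i => by simp
  rw [Set.eq_empty_iff_forall_notMem]
  constructor
  · intro h
    have hloop : ∀ i, (G i).1 ≠ (G i).2 := fun i hi => by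
      refine h ({(G i).1}, {((G i).1, (G i).1, i)}) ⟨?_, Or.inl ⟨_, _, rfl⟩⟩
      rw [singleton_subset_iff, mem_edges]
      exact Prod.ext rfl hi.symm
    refine fun e => ⟨fun he => ?_, ?_⟩
    · by_contra h0
      rw [Multigraph.mult, ← ne_eq, card_ne_zero] at h0
      obtain ⟨i, hi⟩ := h0
      rw [hmem] at hi
      rw [← hi, Sym2.mk_isDiag_iff] at he
      exact hloop i he
    · by_contra h1
      rw [not_le, Multigraph.mult, one_lt_card] at h1
      obtain ⟨i, hi, j, hj, hij⟩ := h1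
      rw [hmem] at hi hj
      rw [← hi, Sym2.eq_iff] at hj
      rcases hj with ⟨h1, h2⟩ | ⟨h1, h2⟩
      · refine h ({(G i).1, (G i).2}, {((G i).1, (G i).2, i), ((G i).1, (G i).2, j)})
          ⟨?_, Or.inr ⟨_, _, i, j, hloop i, hij, Or.inl rfl⟩⟩
        rw [insert_subset_iff, singleton_subset_iff, mem_edges, mem_edges]
        exact ⟨rfl, Prod.ext h1 h2⟩
      · refine h ({(G i).1, (G i).2}, {((G i).1, (G i).2, i), ((G i).2, (G i).1, j)})
          ⟨?_, Or.inr ⟨_, _, i, j, hloop i, hij, Or.inr rfl⟩⟩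
        rw [insert_subset_iff, singleton_subset_iff, mem_edges, mem_edges]
        exact ⟨rfl, Prod.ext h1 h2⟩
  · rintro h p ⟨hp, ⟨v, e, rfl⟩ | ⟨v, w, e, f, hvw, hef, hp'⟩⟩
    · rw [singleton_subset_iff, mem_edges] at hp
      have h0 := (h s(v, v)).1 rfl
      rw [Multigraph.mult, card_eq_zero] at h0
      have : e ∈ (univ.filter fun i => s((G i).1, (G i).2) = s(v, v)) := by
        rw [hmem, hp]
      rw [h0] at this
      simp at this
    · have key : s((G e).1, (G e).2) = s(v, w) ∧ s((G f).1, (G f).2) = s(v, w) := by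
        rcases hp' with rfl | rfl <;>
        · rw [insert_subset_iff, singleton_subset_iff, mem_edges, mem_edges] at hp
          obtain ⟨h1, h2⟩ := hp
          dsimp only at h1 h2
          rw [h1, h2]
          simp
      have h1 := (h s(v, w)).2
      rw [Multigraph.mult, card_le_one] at h1
      exact hef (h1 e ((hmem _ _).2 key.1) f ((hmem _ _).2 key.2))

/-- Every vertex lies in a loop or a double edge, hence has degree at least 2, and the degrees sum
to 2m. Patchworks therefore have nonnegative excess. -/
theorem le_of_isPatchwork {P : Finset (Part n m)} (h : IsPatchwork P) : n ≤ m := by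
  obtain ⟨G, h1, -, h3⟩ := h
  have hdeg : ∀ v : Fin n, 2 ≤ ∑ i, ((if (G i).1 = v then 1 else 0) +
      (if (G i).2 = v then 1 else 0)) := by
    intro v
    have hv := mem_univ v
    rw [← h1, mem_sup] at hv
    obtain ⟨p, hp, hvp⟩ := hv
    obtain ⟨hsub, ⟨u, e, rfl⟩ | ⟨u, w, e, f, -, hef, hp'⟩⟩ := h3 p hp
    · rw [singleton_subset_iff, mem_edges] at hsub
      dsimp only at hsub hvp
      rw [mem_singleton] at hvp
      refine le_trans ?_ (Finset.single_le_sum (fun _ _ => Nat.zero_le _) (mem_univ e))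
      simp [hsub, hvp]
    · have key : ∀ x ∈ ({e, f} : Finset (Fin m)), 1 ≤ ((if (G x).1 = v then 1 else 0) +
          (if (G x).2 = v then 1 else 0)) := by
        rcases hp' with rfl | rfl <;>
        · rw [insert_subset_iff, singleton_subset_iff, mem_edges, mem_edges] at hsub
          obtain ⟨h1, h2⟩ := hsub
          dsimp only at h1 h2 hvp
          rw [mem_insert, mem_singleton] at hvp
          intro x hx
          rw [mem_insert, mem_singleton] at hx
          rcases hx with rfl | rfl <;> rcases hvp with rfl | rfl <;> simp [h1, h2]
      calc 2 = ({e, f} : Finset (Fin m)).card • 1 := by rw [card_pair hef]; rfl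
        _ ≤ _ := Finset.card_nsmul_le_sum _ _ _ key
        _ ≤ _ := Finset.sum_le_sum_of_subset (subset_univ _)
  have hsum := Finset.sum_le_sum fun v (_ : v ∈ univ) => hdeg v
  rw [Finset.sum_comm] at hsum
  simp [Finset.sum_add_distrib] at hsum
  omega

/-! ### Relabelling of vertices and edges in patchworks. -/

section Relabel

variable {a l : ℕ} (f : Fin a ↪ Fin n) (g : Fin l ↪ Fin m)

/-- Relabelling of edges. -/
def edgeMap : Fin a × Fin a × Fin l ↪ Fin n × Fin n × Fin m := f.prodMap (f.prodMap g)

/-- Relabelling of parts. -/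
def partMap : Part a l ↪ Part n m :=
  (mapEmbedding f).toEmbedding.prodMap (mapEmbedding (edgeMap f g)).toEmbedding

variable {f g}

theorem partMap_apply (p : Part a l) :
    partMap f g p = (p.1.map f, p.2.map (edgeMap f g)) := rfl

theorem edgeMap_apply (t : Fin a × Fin a × Fin l) :
    edgeMap f g t = (f t.1, f t.2.1, g t.2.2) := rfl

theorem IsPart.map {p : Part a l} (h : IsPart p) : IsPart (partMap f g p) := by
  rcases h with ⟨v, e, rfl⟩ | ⟨v, w, e, f', h1, h2, rfl | rfl⟩
  · exact Or.inl ⟨f v, g e, by simp [partMap_apply, edgeMap_apply]⟩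
  · exact Or.inr ⟨f v, f w, g e, g f', f.injective.ne h1, g.injective.ne h2,
      Or.inl (by simp [partMap_apply, edgeMap_apply])⟩
  · exact Or.inr ⟨f v, f w, g e, g f', f.injective.ne h1, g.injective.ne h2,
      Or.inr (by simp [partMap_apply, edgeMap_apply])⟩

theorem IsPart.exists_map {p : Part n m} (h : IsPart p) (h1 : p.1 ⊆ univ.map f)
    (h2 : p.2.image (fun t => t.2.2) ⊆ univ.map g) :
    ∃ p' : Part a l, IsPart p' ∧ partMap f g p' = p := by
  have hf : ∀ v ∈ p.1, ∃ v', f v' = v := fun v hv => by simpa using h1 hv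
  have hg : ∀ t ∈ p.2, ∃ e', g e' = t.2.2 := fun t ht => by
    simpa using h2 (mem_image_of_mem _ ht)
  rcases h with ⟨v, e, rfl⟩ | ⟨v, w, e, f', hvw, hef, rfl | rfl⟩
  · obtain ⟨v, rfl⟩ := hf v (by simp)
    obtain ⟨e, rfl⟩ := hg (f v, f v, e) (by simp)
    exact ⟨_, Or.inl ⟨v, e, rfl⟩, by simp [partMap_apply, edgeMap_apply]⟩
  · obtain ⟨v, rfl⟩ := hf v (by simp)
    obtain ⟨w, rfl⟩ := hf w (by simp)
    obtain ⟨e, rfl⟩ := hg (f v, f w, e) (by simp)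
    obtain ⟨f', rfl⟩ := hg (f v, f w, f') (by simp)
    exact ⟨_, Or.inr ⟨v, w, e, f', fun h => hvw (by rw [h]), fun h => hef (by rw [h]), Or.inl rfl⟩,
      by simp [partMap_apply, edgeMap_apply]⟩
  · obtain ⟨v, rfl⟩ := hf v (by simp)
    obtain ⟨w, rfl⟩ := hf w (by simp)
    obtain ⟨e, rfl⟩ := hg (f v, f w, e) (by simp)
    obtain ⟨f', rfl⟩ := hg (f w, f v, f') (by simp)
    exact ⟨_, Or.inr ⟨v, w, e, f', fun h => hvw (by rw [h]), fun h => hef (by rw [h]), Or.inr rfl⟩,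
      by simp [partMap_apply, edgeMap_apply]⟩

theorem sup_fst_map (P : Finset (Part a l)) :
    (P.map (partMap f g)).sup Prod.fst = (P.sup Prod.fst).map f := by
  ext v
  simp only [mem_sup, mem_map, partMap_apply]
  constructor
  · rintro ⟨_, ⟨p, hp, rfl⟩, hv⟩
    obtain ⟨v', h1, h2⟩ := mem_map.1 hv
    exact ⟨v', ⟨p, hp, h1⟩, h2⟩
  · rintro ⟨v', ⟨p, hp, h1⟩, h2⟩
    exact ⟨_, ⟨p, hp, rfl⟩, mem_map.2 ⟨v', h1, h2⟩⟩

theorem sup_snd_map (P : Finset (Part a l)) :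
    (P.map (partMap f g)).sup Prod.snd = (P.sup Prod.snd).map (edgeMap f g) := by
  ext v
  simp only [mem_sup, mem_map, partMap_apply]
  constructor
  · rintro ⟨_, ⟨p, hp, rfl⟩, hv⟩
    obtain ⟨v', h1, h2⟩ := mem_map.1 hv
    exact ⟨v', ⟨p, hp, h1⟩, h2⟩
  · rintro ⟨v', ⟨p, hp, h1⟩, h2⟩
    exact ⟨_, ⟨p, hp, rfl⟩, mem_map.2 ⟨v', h1, h2⟩⟩

theorem labels_map (P : Finset (Part a l)) :
    labels (P.map (partMap f g)) = (labels P).map g := by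
  rw [labels, labels, sup_snd_map]
  ext e
  simp only [mem_image, mem_map, edgeMap_apply]
  constructor
  · rintro ⟨_, ⟨t, ht, rfl⟩, rfl⟩
    exact ⟨_, ⟨t, ht, rfl⟩, rfl⟩
  · rintro ⟨_, ⟨t, ht, rfl⟩, rfl⟩
    exact ⟨_, ⟨t, ht, rfl⟩, rfl⟩

theorem consistent_map_iff (P : Finset (Part a l)) :
    (∀ t ∈ (P.map (partMap f g)).sup Prod.snd, ∀ t' ∈ (P.map (partMap f g)).sup Prod.snd,
      t.2.2 = t'.2.2 → t = t') ↔
    ∀ t ∈ P.sup Prod.snd, ∀ t' ∈ P.sup Prod.snd, t.2.2 = t'.2.2 → t = t' := by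
  rw [sup_snd_map]
  simp only [forall_mem_map, edgeMap_apply, g.injective.eq_iff]
  refine forall₂_congr fun t _ => forall₂_congr fun t' _ => imp_congr_right fun _ => ?_
  exact (edgeMap f g).injective.eq_iff

end Relabel

open Classical in
/-- The signed number of patchworks. -/
def patchCount (a l : ℕ) : ℚ := ∑ P : Finset (Part a l) with IsPatchwork P, (-1 : ℚ) ^ P.card

open Classical in
theorem sum_valid_eq_patchCount (A : Finset (Fin n)) (L : Finset (Fin m)) :
    ∑ P : Finset (Part n m) with IsValid P ∧ P.sup Prod.fst = A ∧ labels P = L,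
      (-1 : ℚ) ^ P.card = patchCount A.card L.card := by
  obtain ⟨f, hf⟩ := exists_map_univ_fin A
  obtain ⟨g, hg⟩ := exists_map_univ_fin L
  symm
  refine Finset.sum_bij (fun P _ => P.map (partMap f g)) ?_ ?_ ?_ ?_
  · intro P hP
    rw [mem_filter, isPatchwork_iff] at hP
    obtain ⟨-, ⟨h1, h2⟩, h3, h4⟩ := hP
    rw [mem_filter, sup_fst_map, labels_map, h3, h4]
    refine ⟨mem_univ _, ⟨?_, (consistent_map_iff P).2 h2⟩, hf, hg⟩
    intro p hp
    obtain ⟨p', hp', rfl⟩ := mem_map.1 hp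
    exact (h1 p' hp').map
  · intro P _ P' _ h
    exact map_injective _ h
  · intro P hP
    rw [mem_filter] at hP
    obtain ⟨-, ⟨h1, h2⟩, h3, h4⟩ := hP
    have hex : ∀ p ∈ P, ∃ p', IsPart p' ∧ partMap f g p' = p := fun p hp => by
      refine (h1 p hp).exists_map ?_ ?_
      · rw [hf, ← h3]
        exact Finset.le_sup (f := Prod.fst) hp
      · rw [hg, ← h4, labels]
        exact image_subset_image (Finset.le_sup (f := Prod.snd) hp)
    -- All vertices and labels of P lie in the ranges of f and g, so every part has a preimage and P
    -- is recovered from its preimage.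
    have hmap : (univ.filter fun p' => partMap f g p' ∈ P).map (partMap f g) = P := by
      ext p
      simp only [mem_map, mem_filter, mem_univ, true_and]
      constructor
      · rintro ⟨p', h, rfl⟩
        exact h
      · intro hp
        obtain ⟨p', -, rfl⟩ := hex p hp
        exact ⟨p', hp, rfl⟩
    refine ⟨univ.filter fun p' => partMap f g p' ∈ P, ?_, hmap⟩
    rw [mem_filter, isPatchwork_iff]
    refine ⟨mem_univ _, ⟨?_, ?_⟩, ?_, ?_⟩
    · intro p' hp'
      obtain ⟨p'', h, h'⟩ := hex _ (mem_filter.1 hp').2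
      rwa [← (partMap f g).injective h']
    · rw [← consistent_map_iff (f := f) (g := g), hmap]
      exact h2
    · rw [← map_inj (f := f), ← sup_fst_map (g := g), hmap, h3, hf]
    · rw [← map_inj (f := g), ← labels_map (f := f), hmap, h4, hg]
  · intro P _
    rw [card_map]

end Patchwork

/-! ### Inclusion-exclusion over loops and double edges. -/

section InclusionExclusion

variable {n m : ℕ}

theorem card_filter_forall_mem_LD {P : Finset (Part n m)} [DecidablePred fun G : Multigraph n m => ∀ p ∈ P, p ∈ LD G]
    (hP : IsValid P) :
    (univ.filter fun G : Multigraph n m => ∀ p ∈ P, p ∈ LD G).card =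
      (n * n) ^ (m - (labels P).card) := by
  rw [labels, ← card_filter_subset_edges hP.2]
  congr 1
  ext G
  simp only [mem_filter, mem_univ, true_and, forall_mem_LD_iff]
  exact ⟨fun h => h.2, fun h => ⟨hP.1, h⟩⟩

open Classical in
-- A multigraph is simple exactly when it has no loop or double edge. Exchanging the sum over
-- multigraphs with the signed sum over subsets of `LD G` leaves patchworks on a vertices and j
-- labels, the other m - j edges being arbitrary.
theorem card_filter_isSimple (n m : ℕ) :
    ((univ.filter fun G : Multigraph n m => IsSimple G.mult).card : ℚ) =
      ∑ j ∈ range (m + 1), (m.choose j : ℚ) * ((n : ℚ) * n) ^ (m - j) *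
        ∑ a ∈ range (n + 1), (n.choose a : ℚ) * patchCount a j := by
  -- The alternating sum over the subsets of a finite set vanishes unless the set is empty.
  have h1 : ∀ G : Multigraph n m, (if IsSimple G.mult then (1 : ℚ) else 0) =
      ∑ P : Finset (Part n m), if ∀ p ∈ P, p ∈ LD G then (-1 : ℚ) ^ P.card else 0 := fun G => by
    have h := Finset.sum_powerset_neg_one_pow_card (x := univ.filter (· ∈ LD G))
    have h' := congrArg (Int.cast : ℤ → ℚ) h
    push_cast at h'
    have he : (univ.filter (· ∈ LD G)) = ∅ ↔ IsSimple G.mult := by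
      rw [← LD_eq_empty_iff, filter_eq_empty_iff, Set.eq_empty_iff_forall_notMem]
      simp
    simp only [he] at h'
    rw [← h', ← Finset.sum_filter]
    refine Finset.sum_congr ?_ fun _ _ => rfl
    ext P
    simp [Finset.subset_iff]
  have h2 : ∀ P : Finset (Part n m), ∑ G : Multigraph n m,
      (if ∀ p ∈ P, p ∈ LD G then (-1 : ℚ) ^ P.card else 0) =
        if IsValid P then ((n : ℚ) * n) ^ (m - (labels P).card) * (-1 : ℚ) ^ P.card else 0 := by
    intro P
    refine (Finset.sum_filter _ _).symm.trans ?_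
    rw [sum_const, nsmul_eq_mul]
    split_ifs with hP
    · rw [card_filter_forall_mem_LD hP]
      push_cast
      rfl
    -- An invalid set of parts is contained in no `LD G`.
    · rw [filter_false_of_mem, card_empty, Nat.cast_zero, zero_mul]
      intro G _ h
      have h4 := forall_mem_LD_iff.1 h
      exact hP ⟨h4.1, fun t ht t' ht' => eq_of_mem_edges (h4.2 ht) (h4.2 ht')⟩
  rw [← Finset.sum_boole, Finset.sum_congr rfl fun G _ => h1 G, Finset.sum_comm,
    Finset.sum_congr rfl fun P _ => h2 P, ← Finset.sum_filter,
    ← Finset.sum_fiberwise _ (fun P => (P.sup Prod.fst, labels P)), ← univ_product_univ,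
    Finset.sum_product]
  have h3 : ∀ (A : Finset (Fin n)) (L : Finset (Fin m)),
      (∑ P ∈ (univ.filter fun P : Finset (Part n m) => IsValid P) with
        (P.sup Prod.fst, labels P) = (A, L),
          ((n : ℚ) * n) ^ (m - (labels P).card) * (-1 : ℚ) ^ P.card) =
        ((n : ℚ) * n) ^ (m - L.card) * patchCount A.card L.card := fun A L => by
    rw [← sum_valid_eq_patchCount, Finset.mul_sum, filter_filter]
    refine Finset.sum_congr ?_ fun P hP => ?_
    · ext P
      simp [Prod.ext_iff]
    · rw [(mem_filter.1 hP).2.2.2]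
  simp only [h3]
  -- The summand depends only on the cardinalities of A and L, which produces the binomial
  -- coefficients.
  rw [Finset.sum_comm, ← powerset_univ]
  have h4 : ∀ L : Finset (Fin m), ∑ A : Finset (Fin n),
      ((n : ℚ) * n) ^ (m - L.card) * patchCount A.card L.card =
        ((n : ℚ) * n) ^ (m - L.card) *
          ∑ a ∈ range (n + 1), (n.choose a : ℚ) * patchCount a L.card := fun L => by
    rw [← Finset.mul_sum, ← powerset_univ,
      Finset.sum_powerset_apply_card (fun a => patchCount a L.card), card_univ, Fintype.card_fin]
    simp only [nsmul_eq_mul]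
  rw [Finset.sum_congr rfl fun L _ => h4 L,
    Finset.sum_powerset_apply_card (fun j => ((n : ℚ) * n) ^ (m - j) *
      ∑ a ∈ range (n + 1), (n.choose a : ℚ) * patchCount a j), card_univ, Fintype.card_fin]
  simp only [nsmul_eq_mul, mul_assoc]

theorem coeff_patchworkGF (a l : ℕ) :
    PowerSeries.coeff l (PowerSeries.coeff a (patchworkGF (-1))) =
      patchCount a l / (2 ^ l * (l ! : ℚ) * (a ! : ℚ)) := by
  rw [patchworkGF, PowerSeries.coeff_mk, PowerSeries.coeff_mk, patchCount]

theorem coeff_patchworkGF_of_lt {a l : ℕ} (h : l < a) :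
    PowerSeries.coeff l (PowerSeries.coeff a (patchworkGF (-1))) = 0 := by
  classical
  rw [coeff_patchworkGF, patchCount, filter_false_of_mem, sum_empty, zero_div]
  intro P _ hP
  have := le_of_isPatchwork hP
  omega

/-- Reassembles the patchwork series from its parts of excess l ≥ 0; nothing is lost since no
patchwork has negative excess. -/
theorem weightedPart_patchwork (a : ℕ) :
    weightedPart (fun l => patchworkPart l (-1)) a = PowerSeries.coeff a (patchworkGF (-1)) := by
  refine PowerSeries.ext fun m => ?_
  rw [weightedPart, PowerSeries.coeff_X_pow_mul']
  split_ifs with h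
  · rw [PowerSeries.coeff_mk, patchworkPart, coeff_excessPart, Nat.add_sub_cancel' h]
  · rw [coeff_patchworkGF_of_lt (by omega)]

/-- Inclusion-exclusion over the loops and double edges. -/
theorem coeff_totalFin_simple (n m : ℕ) :
    PowerSeries.coeff m (totalFin simpleWeight (fun _ _ => True) n) =
      (∑ j ∈ range (m + 1), (m.choose j : ℚ) * ((n : ℚ) * n) ^ (m - j) *
        ∑ a ∈ range (n + 1), (n.choose a : ℚ) * patchCount a j) / (2 ^ m * (m ! : ℚ)) := by
  classical
  have h := ncard_multigraph (fun G : Multigraph n m => IsSimple G.mult) IsSimple fun _ => Iff.rfl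
  have h1 : ({G | IsSimple G.mult} : Set (Multigraph n m)).ncard =
      (univ.filter fun G : Multigraph n m => IsSimple G.mult).card := by
    rw [← Set.ncard_coe_finset]
    congr 1
    ext G
    simp
  -- Both weights equal 1 on simple multiplicity functions, so simple graphs can be counted through
  -- multigraphs.
  have hw : ∀ μ : Sym2 (Fin n) → ℕ, IsSimple μ → weight multiWeight univ μ = 1 := fun μ hμ => by
    refine Finset.prod_eq_one fun e _ => ?_
    by_cases he : e.IsDiag
    · rw [(hμ e).1 he, EdgeWeight.ofMult_zero]
    · rw [ofMult_of_not_isDiag _ he, multiWeight]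
      have := (hμ e).2
      interval_cases μ e <;> simp
  have hs : PowerSeries.coeff m (totalFin simpleWeight (fun _ _ => True) n) =
      ∑ μ ∈ (piAntidiag (univ : Finset (Fin n)).sym2 m).filter IsSimple,
        weight multiWeight univ μ := by
    rw [totalFin, total, PowerSeries.coeff_mk, filter_true_of_mem fun _ _ _ _ => trivial]
    simp only [weight_simple]
    rw [← Finset.sum_filter]
    exact Finset.sum_congr rfl fun μ hμ => (hw μ (mem_filter.1 hμ).2).symm
  have hm : (m ! : ℚ) ≠ 0 := by exact_mod_cast Nat.factorial_ne_zero _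
  rw [hs, ← card_filter_isSimple, ← h1, h]
  field_simp

/-- The binomials in m and in n turn the inclusion-exclusion count into a product of the patchwork
series, free isolated labels 1/b!, and e^{n²w/2}. -/
theorem egf_totalFin_simple : egf (totalFin simpleWeight fun _ _ => True) =
    totalGF fun l => patchworkPart l (-1) := by
  refine PowerSeries.ext fun n => PowerSeries.ext fun m => ?_
  have hn : (n ! : ℚ) ≠ 0 := by exact_mod_cast Nat.factorial_ne_zero _
  rw [coeff_egf, coeff_totalFin_simple, totalGF, PowerSeries.coeff_mk, PowerSeries.coeff_mul,
    Finset.Nat.sum_antidiagonal_eq_sum_range_succ (fun i j => PowerSeries.coeff i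
      (∑ q ∈ antidiagonal n, weightedPart (fun l => patchworkPart l (-1)) q.1 *
        PowerSeries.C (1 / (q.2 ! : ℚ))) * PowerSeries.coeff j (gaussExp n)),
    Finset.sum_div, Finset.sum_div]
  refine Finset.sum_congr rfl fun j hj => ?_
  have hjm : j ≤ m := by simpa [Nat.lt_succ_iff] using hj
  rw [map_sum, Finset.Nat.sum_antidiagonal_eq_sum_range_succ (fun a b => PowerSeries.coeff j
    (weightedPart (fun l => patchworkPart l (-1)) a * PowerSeries.C (1 / (b ! : ℚ)))),
    Finset.mul_sum, Finset.sum_div, Finset.sum_div, Finset.sum_mul]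
  refine Finset.sum_congr rfl fun a ha => ?_
  have han : a ≤ n := by simpa [Nat.lt_succ_iff] using ha
  have h1 : (m ! : ℚ) ≠ 0 := by exact_mod_cast Nat.factorial_ne_zero _
  have h2 : (j ! : ℚ) ≠ 0 := by exact_mod_cast Nat.factorial_ne_zero _
  have h3 : ((m - j)! : ℚ) ≠ 0 := by exact_mod_cast Nat.factorial_ne_zero _
  have h4 : (a ! : ℚ) ≠ 0 := by exact_mod_cast Nat.factorial_ne_zero _
  have h5 : ((n - a)! : ℚ) ≠ 0 := by exact_mod_cast Nat.factorial_ne_zero _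
  rw [PowerSeries.coeff_mul_C, weightedPart_patchwork, coeff_patchworkGF, gaussExp,
    coeff_rescale_exp, smul_eq_mul, Nat.cast_choose ℚ hjm, Nat.cast_choose ℚ han, div_pow,
    ← pow_two]
  have hpow : (2 : ℚ) ^ m = 2 ^ j * 2 ^ (m - j) := by rw [← pow_add, Nat.add_sub_cancel' hjm]
  rw [hpow]
  field_simp

end InclusionExclusion

/-- The patchwork series of the multigraph case: only the empty patchwork. -/
def trivialPart (l : ℕ) : ℚ⟦X⟧ := if l = 0 then 1 else 0

theorem egf_totalFin_multi :
    egf (totalFin multiWeight fun _ _ => True) = totalGF trivialPart := by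
  refine PowerSeries.ext fun n => ?_
  have h0 : ∀ a, weightedPart trivialPart a = if a = 0 then 1 else 0 := fun a => by
    rw [weightedPart]
    split_ifs with h
    · subst h
      refine PowerSeries.ext fun l => ?_
      rw [pow_zero, one_mul, PowerSeries.coeff_mk, PowerSeries.coeff_one, trivialPart]
      split_ifs <;> simp
    · rw [show (PowerSeries.mk fun l => PowerSeries.coeff a (trivialPart l)) = 0 from
        PowerSeries.ext fun l => by
          rw [PowerSeries.coeff_mk, trivialPart]
          split_ifs <;> simp [PowerSeries.coeff_one, h], mul_zero]
  rw [egf, totalGF, PowerSeries.coeff_mk, PowerSeries.coeff_mk, totalFin_multi_true]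
  congr 1
  rw [Finset.Nat.sum_antidiagonal_eq_sum_range_succ (fun a b => weightedPart trivialPart a *
    PowerSeries.C (1 / (b ! : ℚ))), Finset.sum_eq_single 0]
  · simp [h0]
  · intro a _ ha
    rw [h0, if_neg ha, zero_mul]
  · simp

/-- The part of excess -1 of the logarithm of the graph series is U by the saddle point identity and
counts trees by the exponential formula. Rooting then gives T, without decomposing a tree at its
root. -/
theorem treeSeries_eq : treeSeries = rootedTreeGF := by
  refine PowerSeries.ext fun n => ?_
  cases n with
  | zero =>
    rw [PowerSeries.coeff_zero_eq_constantCoeff_apply, constantCoeff_treeSeries,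
      PowerSeries.coeff_zero_eq_constantCoeff_apply, constantCoeff_rootedTreeGF]
  | succ n =>
    rw [coeff_rootedTreeGF, coeff_log_tree (P := fun l => patchworkPart l (-1)),
      coeff_unrootedSeries]
    · rw [← egf_totalFin_simple, constantCoeff_egf, totalFin_zero]
    · rw [simpleLog, constantCoeff_egf, connectedFin_zero]
    · rw [← egf_totalFin_simple]
      exact derivative_egf_totalFin _ _

theorem excessPart_egf_positive {ω : EdgeWeight} {P : ℕ → ℚ⟦X⟧}
    (h : egf (totalFin ω fun _ _ => True) = totalGF P) (k : ℕ) :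
    excessPart (egf (totalFin ω (· < ·))) k = substSelf rootedTreeGF (closedForm P k) *
      expOf (-excessPart (egf (connectedFin ω fun _ _ => True)) 0) := by
  rw [← treeSeries_eq]
  refine excessPart_positive ?_ ?_ ?_ ?_ ?_ k
  · rw [← h, constantCoeff_egf, totalFin_zero]
  · rw [constantCoeff_egf, connectedFin_zero]
  · rw [← h]
    exact derivative_egf_totalFin _ _
  · rw [constantCoeff_egf, totalFin_zero]
  · rw [positivePart_egf_connectedFin]
    exact derivative_egf_totalFin _ _

theorem substSelf_zero {R : Type*} [CommRing R] (A : R⟦X⟧) : substSelf A 0 = 0 := by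
  rw [← map_zero (PowerSeries.C (R := R)), substSelf_C]

theorem comp_one {T : ℚ⟦X⟧} (hT : PowerSeries.constantCoeff T = 0) (g : ℚ⟦X⟧) :
    comp 1 (inZ T * inX g) = 1 := by
  rw [comp_inZ_mul_inX hT, show inZ 1 = 1 from map_one _, map_one, substSelf_one]

theorem comp_zero {T : ℚ⟦X⟧} (hT : PowerSeries.constantCoeff T = 0) (g : ℚ⟦X⟧) :
    comp 0 (inZ T * inX g) = 0 := by
  rw [comp_inZ_mul_inX hT, show inZ 0 = 0 from map_zero _, map_zero, substSelf_zero]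

theorem coeffX_zero (d : ℕ) : coeffX d 0 = 0 := by
  refine PowerSeries.ext fun n => ?_
  rw [coeff_coeffX, map_zero, map_zero, map_zero]

end Enumeration

end PosExcess

end

theorem mainTheorem3 (k : ℕ) :
    PosExcess.sgPos k =
        ∑ l ∈ Finset.range (k + 1),
          PosExcess.oddDoubleFactorial (k - l) •
            PosExcess.coeffX (2 * (k - l))
              (PosExcess.comp (PosExcess.patchworkPart l (-1))
                  (PosExcess.inZ PosExcess.rootedTreeGF *
                    PosExcess.inX (PowerSeries.exp ℚ)) *
                PosExcess.inZ (PosExcess.expOf (-PosExcess.unicycleGF)) *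
                PosExcess.invOneSubRPow
                  (PosExcess.inZ PosExcess.rootedTreeGF * PosExcess.inX PosExcess.phi)
                  (((k - l : ℕ) : ℚ) + 1 / 2)) ∧
      PosExcess.mgPos k =
        PosExcess.oddDoubleFactorial k •
          PosExcess.coeffX (2 * k)
            (PosExcess.inZ (PosExcess.expOf (-PosExcess.multiUnicycleGF)) *
              PosExcess.invOneSubRPow
                (PosExcess.inZ PosExcess.rootedTreeGF * PosExcess.inX PosExcess.phi)
                ((k : ℚ) + 1 / 2)) ∧
      ∀ n : ℕ, PowerSeries.coeff n (PosExcess.sgPos k) ≤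
        PowerSeries.coeff n (PosExcess.mgPos k) := by
  have hT := PosExcess.constantCoeff_rootedTreeGF
  refine ⟨?_, ?_, fun n => ?_⟩
  · rw [PosExcess.sgPos, PosExcess.graphGF_posGraphs,
      PosExcess.excessPart_egf_positive PosExcess.egf_totalFin_simple,
      PosExcess.substSelf_closedForm_mul hT]
    rw [← PosExcess.excessPart_simpleLog]
    rfl
  · rw [PosExcess.mgPos, PosExcess.multigraphGF_posMultigraphs,
      PosExcess.excessPart_egf_positive PosExcess.egf_totalFin_multi,
      PosExcess.substSelf_closedForm_mul hT, Finset.sum_eq_single 0]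
    · rw [Nat.sub_zero, PosExcess.trivialPart, if_pos rfl, PosExcess.comp_one hT, one_mul,
        ← PosExcess.excessPart_multiLog]
      rfl
    -- Without patchworks only l = 0 contributes.
    · intro l _ hl
      rw [PosExcess.trivialPart, if_neg hl, PosExcess.comp_zero hT, zero_mul, zero_mul,
        PosExcess.coeffX_zero, smul_zero]
    · simp
  · rw [PosExcess.sgPos, PosExcess.mgPos, PosExcess.graphGF_posGraphs,
      PosExcess.multigraphGF_posMultigraphs, PosExcess.coeff_excessPart,
      PosExcess.coeff_excessPart, PosExcess.coeff_egf, PosExcess.coeff_egf]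
    -- Both coefficients sum over the same multiplicity functions, and the comparison is termwise.
    exact div_le_div_of_nonneg_right (PosExcess.coeff_totalFin_le _ _ _) (by positivity)
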